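/- **Definitions.** For a probability measure $\mu$ on $[0,\infty)$ with mean $m=\int x\,\mu(dx)\in(0,\infty)$ let $\mu_{sb}(dx)=m^{-1}x\,\mu(dx)$ be its size-biased law. A non-negative random variable $\eta$ with law $\mu$ is said to solve (2) with $\rho=\mathcal L(A)$ if $0<\mathbb E\eta<\infty$ and $$\eta_{sb}\overset d= A\,\eta_{sb}+\eta ,\tag{2}$$ where on the right-hand side $A\sim\rho$, $\eta_{sb}\sim\mu_{sb}$ and $\eta\sim\mu$ are independent. A response function is a right-continuous non-increasing $h:(0,\infty)\to[0,\infty)$; its generalized inverse is the right-continuous non-increasing function $h^{\leftarrow}(z)=\inf\{u>0: h(u)\le z\}$, $z>0$ (with $\inf\emptyset=\infty$). For $0<\lambda<\infty$ the Poisson shot-noise transform is $\mathbb T_{h,\lambda}(\mu)=\mathcal L\big(\sum_{i\ge1}\xi_i h(\tau_i)\big)$, where $\xi_1,\xi_2,\dots$ are i.i.d. with law $\mu$, independent of the points $\tau_1<\tau_2<\cdots$ of a Poisson process on $(0,\infty)$ with intensity $\lambda$; its domain consists of the probability measures $\mu$ on $[0,\infty)$ with $\int_0^\infty\int_0^\infty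 (1\wedge h(s)y)\,ds\,\mu(dy)<\infty$. A fixed point of $\mathbb T_{h,\lambda}$ is a $\mu\neq\delta_0$ in this domain with $\mathbb T_{h,\lambda}(\mu)=\mu$. We write $0\log 0=0$, and "$\mathbb E\log A<0$", "$\int h\log h<0$" mean that the integral exists and lies in $[-\infty,0)$. **Proposition 2.1.** (a) Let $0\le a<\infty$, $b\in[-\infty,\infty]$, let $\rho=\mathcal L(A)$ be a probability measure concentrated on $[a,b]$ (on $[a,\infty)$ if $b=\infty$) with $\mathbb P(A=0)=0$ and $\mathbb E\log A<0$, and let $\eta$ with law $\mu$ solve (2) with $\rho$. Then there is exactly one response function $h$ with $$h^{\leftarrow}(x)=\int_{(x,b]}z^{-1}\rho(dz)\qquad\text{for all }x>0$$ (where $(x,b]$ means $(x,\infty)$ if $b=\infty$), and for this $h$ the law $\mu$ is a fixed point of $\mathbb T_{h,1}$, $\int_0^\infty h(z)\,dz=1$ and $\int_0^\infty h(z)\log h(z)\,dz<0$. (b) Conversely, let $0<\lambda<\infty$, let $h$ be a response function with $\lambda\int_0^\infty h(z)\,dz=1$, $\int_0^\infty h(z)\log h(z)\,dz<0$ and $\lim_{z\to0+}h(z)=b\in(0,\infty]$,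 and let $\mu^*$ be a fixed point of $\mathbb T_{h,\lambda}$. Then $h^{\leftarrow}$ is finite on $(0,\infty)$, and if $-h^{\leftarrow}(dx)$ denotes its Lebesgue–Stieltjes measure on $(0,\infty)$ (giving mass $h^{\leftarrow}(x)-h^{\leftarrow}(y)$ to $(x,y]$ for $0<x\le y$), then $\rho(dx)=-\lambda x\,h^{\leftarrow}(dx)$ is a probability measure, it is concentrated on $[a,b]$ (on $[a,\infty)$ if $b=\infty$) with $a=\inf\{h(u):u>0,\ h(u)>0\}$, and a random variable $\eta$ with law $\mu^*$ solves (2) with an $A$ of law $\rho$; in particular $0<\mathbb E\eta<\infty$. -/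

import Mathlib

open MeasureTheory ProbabilityTheory Set Filter Topology
open scoped ENNReal

noncomputable section

/-- `∫ f dμ` exists in the extended sense and lies in `[-∞, 0)`: the integral of the positive part
is (finite and) strictly smaller than the, possibly infinite, integral of the negative part. -/
def HasNegIntegral {α : Type*} [MeasurableSpace α] (f : α → ℝ) (μ : Measure α) : Prop :=
  ∫⁻ x, ENNReal.ofReal (f x) ∂μ < ∫⁻ x, ENNReal.ofReal (-f x) ∂μ

/-- Probability measures on the Borel sets of `[0, ∞)`, seen as measures on `ℝ`. -/
structure IsNonnegLaw (μ : Measure ℝ) : Prop where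
  isProb : IsProbabilityMeasure μ
  neg_null : μ (Iio 0) = 0

/-- `μ` is concentrated on the interval `[a, b]`; for `b = ⊤` this interval is `[a, ∞)`. -/
def ConcentratedOn (μ : Measure ℝ) (a : ℝ) (b : EReal) : Prop :=
  μ ({z : ℝ | a ≤ z ∧ (z : EReal) ≤ b}ᶜ) = 0

/-- The mean of a law on `[0, ∞)`, possibly infinite. -/
def lawMean (μ : Measure ℝ) : ℝ≥0∞ := ∫⁻ x, ENNReal.ofReal x ∂μ

/-- The size-biased law `m⁻¹ x μ(dx)` of a law `μ` on `[0, ∞)` with mean `m ∈ (0, ∞)`. -/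
def sizeBiased (μ : Measure ℝ) : Measure ℝ :=
  (lawMean μ)⁻¹ • μ.withDensity (fun x => ENNReal.ofReal x)

/-- A random variable `η ≥ 0` with law `μ` satisfies `η_sb = A η_sb + η` in distribution, where
`A` has law `ρ`, `η_sb` has the size-biased law of `η`, and `A`, `η_sb`, `η` on the right-hand side
are independent. The size-biased law makes sense only if the mean is finite and positive. -/
def SolvesPerpetuity (μ ρ : Measure ℝ) : Prop :=
  IsNonnegLaw μ ∧ 0 < lawMean μ ∧ lawMean μ < ⊤ ∧
    sizeBiased μ =
      Measure.map (fun p : (ℝ × ℝ) × ℝ => p.1.1 * p.1.2 + p.2) ((ρ.prod (sizeBiased μ)).prod μ)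

/-- `h : (0, ∞) → [0, ∞)` is right-continuous and non-increasing. Functions on `(0, ∞)` are
represented by functions on `ℝ` whose values outside `(0, ∞)` are irrelevant. -/
structure IsResponse (h : ℝ → ℝ) : Prop where
  nonneg : ∀ u, 0 < u → 0 ≤ h u
  anti : AntitoneOn h (Ioi 0)
  right_cont : ∀ u, 0 < u → ContinuousWithinAt h (Ioi u) u

/-- The right-continuous generalized inverse `h^←(z) = inf {u > 0 : h(u) ≤ z}`, with `inf ∅ = ∞`. -/
def genInv (h : ℝ → ℝ) (z : ℝ) : ℝ≥0∞ :=
  sInf (ENNReal.ofReal '' {u : ℝ | 0 < u ∧ h u ≤ z})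

/-- `ν` is the Lebesgue-Stieltjes measure `-g(dx)` on `(0, ∞)` of the non-increasing
right-continuous function `g : (0, ∞) → [0, ∞)`. -/
structure IsNegStieltjes (g : ℝ → ℝ≥0∞) (ν : Measure ℝ) : Prop where
  finite : ∀ x, 0 < x → g x < ⊤
  nonpos_null : ν (Iic 0) = 0
  Ioc_eq : ∀ x y, 0 < x → x ≤ y → ν (Ioc x y) = g x - g y

/-- The domain of the shot-noise transform with response function `h`: the laws `μ` on `[0, ∞)`
with `∫∫ min(1, h(s) y) ds μ(dy) < ∞`. -/
def InShotNoiseDomain (h : ℝ → ℝ) (μ : Measure ℝ) : Prop :=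
  IsNonnegLaw μ ∧ ∫⁻ y, (∫⁻ s in Ioi (0 : ℝ), ENNReal.ofReal (min 1 (h s * y))) ∂μ < ⊤

/-- The joint law of i.i.d. pairs `(ξ_i, e_i)`, `i ∈ ℕ`, where `ξ_i` has law `μ` and is independent
of `e_i`, which is exponential with rate `r`. -/
def shotNoiseBase (r : ℝ) (μ : Measure ℝ) : Measure (ℕ → ℝ × ℝ) :=
  Measure.infinitePi (fun _ : ℕ => μ.prod (expMeasure r))

/-- The points of the Poisson flow on `(0, ∞)`: partial sums of the exponential gaps `e_i`. -/
def poissonPoint (ω : ℕ → ℝ × ℝ) (i : ℕ) : ℝ := ∑ j ∈ Finset.range (i + 1), (ω j).2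

/-- The Poisson shot-noise transform: the law of `∑ ξ_i h(τ_i)`, where the `ξ_i` are i.i.d. with
law `μ`, independent of the Poisson flow `(τ_i)` of intensity `r`. -/
def shotNoiseTransform (h : ℝ → ℝ) (r : ℝ) (μ : Measure ℝ) : Measure ℝ :=
  Measure.map (fun ω => ∑' i, (ω i).1 * h (poissonPoint ω i)) (shotNoiseBase r μ)

/-- `μ` is a (non-zero) fixed point of the shot-noise transform. -/
def IsShotNoiseFixedPoint (h : ℝ → ℝ) (r : ℝ) (μ : Measure ℝ) : Prop :=
  InShotNoiseDomain h μ ∧ μ ≠ Measure.dirac 0 ∧ shotNoiseTransform h r μ = μ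

end

/-! Both properties of `μ` are one equation for its Laplace transform φ. Size-biasing
differentiates: the transform of `sizeBiased μ` is -φ'/m, so (2) reads φ'(s) = φ(s) ∫ φ'(sz) ρ(dz),
which integrates to φ(s) = exp(-∫ (1 - φ(sz)) z⁻¹ ρ(dz)) (`solvesPerpetuity_iff`). Campbell's
formula turns the fixed point property into φ(s) = exp(-λ ∫ (1 - φ(s h(u))) du)
(`lap_shotNoiseTransform`). The image of Lebesgue measure under `h` has tail `genInv h`; weighting
it by λx gives ρ (`responseLaw`). This identifies the two exponents, the mass of ρ with λ ∫ h, and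
the sign of E log A with that of ∫ h log h. In (a), `h` is the inverse of the tail of z⁻¹ ρ(dz).

The differentiation needs a finite mean, which (b) has to prove. Put ψ(s) = (1 - φ(s))/s. From exp x
≥ 1 + x the fixed point equation gives φ(s) E ψ(sA) ≤ ψ(s). Iterating along the products Π_n of
i.i.d. copies of A bounds E[φ(Π_0) ⋯ φ(Π_{n-1}) ψ(Π_n)] by ψ(1). As E log A < 0, the Π_n lie below a
geometric sequence u_n with positive probability; φ and ψ are non-increasing, so φ(u_0) ⋯ φ(u_{n-1})
ψ(u_n) is bounded. The product cannot tend to 0 (`exists_le_prod_of_le`), so ψ(u_n) is bounded, and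
Fatou's lemma bounds the mean.

Campbell's formula comes from a martingale: the Laplace weight of the first n points times exp(-λ
∫_{τ_n}^∞ (1 - φ(s h))) has constant expectation. -/

/-! ### Uniqueness of Laplace transforms on the half-line -/

/-- The powers of exp(-x) span a point-separating algebra of bounded continuous functions, and such
an algebra determines finite measures on a Polish space. Integer parameters therefore suffice. -/
theorem ext_of_integral_exp_neg_nnreal {μ ν : Measure NNReal} [IsFiniteMeasure μ]
    [IsFiniteMeasure ν]
    (h : ∀ n : ℕ, ∫ x, Real.exp (-(n * (x : ℝ))) ∂μ = ∫ x, Real.exp (-(n * (x : ℝ))) ∂ν) :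
    μ = ν := by
  let g : BoundedContinuousFunction NNReal ℝ :=
    BoundedContinuousFunction.ofNormedAddCommGroup (fun x : NNReal => Real.exp (-(x : ℝ)))
      (by fun_prop) 1 (fun x => by
        rw [Real.norm_eq_abs, Real.abs_exp]
        exact Real.exp_le_one_iff.2 (neg_nonpos.2 x.2))
  have hg : ∀ x, g x = Real.exp (-(x : ℝ)) := fun x => rfl
  let A : StarSubalgebra ℝ (BoundedContinuousFunction NNReal ℝ) :=
    { Algebra.adjoin ℝ {g} with
      star_mem' := fun {a} ha => by
        have : star a = a := by ext x; simp
        rw [this]; exact ha }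
  refine ext_of_forall_mem_subalgebra_integral_eq_of_polish (𝕜 := ℝ) (A := A) ?_ ?_
  · intro x y hxy
    refine ⟨g, ⟨_, ⟨g, Algebra.subset_adjoin rfl, rfl⟩, rfl⟩, ?_⟩
    rw [hg, hg]
    intro h
    exact hxy (NNReal.coe_injective (neg_injective (Real.exp_injective h)))
  · intro f hf
    have hf' : f ∈ Algebra.adjoin ℝ {g} := hf
    rw [← Subalgebra.mem_toSubmodule, Algebra.adjoin_eq_span] at hf'
    have hint : ∀ (κ : Measure NNReal) [IsFiniteMeasure κ]
      (f : BoundedContinuousFunction NNReal ℝ), Integrable f κ := fun κ _ f => f.integrable κ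
    clear hf
    induction hf' using Submodule.span_induction with
    | mem f hf =>
      obtain ⟨n, rfl⟩ := Submonoid.mem_closure_singleton.1 hf
      have : ∀ x, (g ^ n) x = Real.exp (-(n * (x : ℝ))) := fun x => by
        rw [BoundedContinuousFunction.pow_apply, hg, ← Real.exp_nat_mul]; congr 1; ring
      simp only [this, h n]
    | zero => simp
    | add f₁ f₂ h₁ h₂ ih₁ ih₂ =>
      simp only [BoundedContinuousFunction.coe_add, Pi.add_apply]
      rw [integral_add (hint μ _) (hint μ _), integral_add (hint ν _) (hint ν _), ih₁, ih₂]
    | smul c f₁ h₁ ih₁ =>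
      simp only [BoundedContinuousFunction.coe_smul]
      rw [integral_smul, integral_smul, ih₁]

theorem map_toNNReal_map_coe {μ : Measure ℝ} (h : μ (Iio 0) = 0) :
    (μ.map Real.toNNReal).map (fun x : NNReal => (x : ℝ)) = μ := by
  rw [Measure.map_map (by fun_prop) (by fun_prop)]
  conv_rhs => rw [← Measure.map_id (μ := μ)]
  refine Measure.map_congr ?_
  have : ∀ᵐ x ∂μ, ¬ x ∈ Iio (0 : ℝ) := measure_eq_zero_iff_ae_notMem.1 h
  filter_upwards [this] with x hx
  simp only [mem_Iio, not_lt] at hx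
  simp [hx]

/-- A finite measure on `[0, ∞)` is determined by its Laplace transform. -/
theorem ext_of_laplace {μ ν : Measure ℝ} [IsFiniteMeasure μ] [IsFiniteMeasure ν]
    (hμ : μ (Iio 0) = 0) (hν : ν (Iio 0) = 0)
    (h : ∀ s : ℝ, 0 ≤ s → ∫ x, Real.exp (-(s * x)) ∂μ = ∫ x, Real.exp (-(s * x)) ∂ν) : μ = ν := by
  rw [← map_toNNReal_map_coe hμ, ← map_toNNReal_map_coe hν]
  congr 1
  refine ext_of_integral_exp_neg_nnreal fun n => ?_
  have key : ∀ κ : Measure ℝ, κ (Iio 0) = 0 →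
      ∫ x, Real.exp (-(n * (x : ℝ))) ∂(κ.map Real.toNNReal) = ∫ x, Real.exp (-(n * x)) ∂κ := by
    intro κ hκ
    conv_rhs => rw [← map_toNNReal_map_coe hκ]
    exact (integral_map (f := fun x : ℝ => Real.exp (-(n * x)))
      (φ := fun x : NNReal => (x : ℝ)) (by fun_prop) (by fun_prop)).symm
  rw [key μ hμ, key ν hν, h n (Nat.cast_nonneg n)]

/-! ### Recursions driven by i.i.d. sequences -/

/-- Prepend an entry to a sequence. -/
def seqCons {E : Type*} (p : E × (ℕ → E)) : ℕ → E
  | 0 => p.1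
  | n + 1 => p.2 n

theorem measurable_seqCons {E : Type*} [MeasurableSpace E] :
    Measurable (seqCons : E × (ℕ → E) → ℕ → E) := by
  refine measurable_pi_lambda _ fun n => ?_
  cases n with
  | zero => exact measurable_fst
  | succ n => exact (measurable_pi_apply n).comp measurable_snd

/-- This splits off the first entry of an i.i.d. sequence, which is what conditioning on the first
step requires. -/
theorem map_seqCons_infinitePi {E : Type*} [MeasurableSpace E] (κ : Measure E)
    [IsProbabilityMeasure κ] :
    (κ.prod (Measure.infinitePi fun _ : ℕ => κ)).map seqCons =
      Measure.infinitePi fun _ : ℕ => κ := by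
  refine Measure.eq_infinitePi (fun _ : ℕ => κ) fun s t ht => ?_
  classical
  -- The cylinder is padded to a full initial segment of indices, so that its preimage under
  -- `seqCons` is a rectangle.
  let t' : ℕ → Set E := fun i => if i ∈ s then t i else univ
  have ht' : ∀ i, MeasurableSet (t' i) := fun i => by
    simp only [t']; split_ifs <;> simp [ht]
  obtain ⟨N, hN⟩ : ∃ N, s ⊆ Finset.range (N + 1) :=
    ⟨s.sup id, fun i hi => Finset.mem_range.2 (Nat.lt_succ_of_le (Finset.le_sup (f := id) hi))⟩
  have e1 : Set.pi (s : Set ℕ) t = Set.pi (Finset.range (N + 1) : Set ℕ) t' := by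
    ext ω
    simp only [Set.mem_pi, Finset.mem_coe, t']
    constructor
    · intro h i _
      split_ifs with his
      · exact h i his
      · trivial
    · intro h i hi
      have := h i (hN hi)
      rwa [if_pos hi] at this
  have e2 : ∏ i ∈ s, κ (t i) = ∏ i ∈ Finset.range (N + 1), κ (t' i) := by
    rw [← Finset.prod_subset hN]
    · exact Finset.prod_congr rfl fun i hi => by simp [t', hi]
    · intro i _ hi; simp [t', hi]
  have e3 : seqCons ⁻¹' Set.pi (Finset.range (N + 1) : Set ℕ) t' =
      t' 0 ×ˢ Set.pi (Finset.range N : Set ℕ) (fun i => t' (i + 1)) := by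
    ext ⟨e, ω⟩
    simp only [mem_preimage, Set.mem_pi, Finset.mem_coe, Finset.mem_range, mem_prod]
    constructor
    · intro h
      exact ⟨h 0 (by omega), fun i hi => h (i + 1) (by omega)⟩
    · rintro ⟨h0, h⟩ i hi
      cases i with
      | zero => exact h0
      | succ i => exact h i (by omega)
  rw [Measure.map_apply measurable_seqCons (MeasurableSet.pi s.countable_toSet fun i _ => ht i),
    e1, e2, e3, Measure.prod_prod, Measure.infinitePi_pi _ (fun i _ => ht' (i + 1)),
    Finset.prod_range_succ', mul_comm]

/-- The states of the recursion `x ↦ f x e` driven by the sequence `ω`. -/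
def iterState {S E : Type*} (f : S → E → S) (x : S) (ω : ℕ → E) : ℕ → S
  | 0 => x
  | n + 1 => f (iterState f x ω n) (ω n)

/-- The weighted transition operator of the recursion `x ↦ f x e` with `e` of law `κ`. -/
noncomputable def weightedStep {S E : Type*} [MeasurableSpace E] (κ : Measure E) (f : S → E → S)
    (w : S → E → ℝ≥0∞) (V : S → ℝ≥0∞) (x : S) : ℝ≥0∞ :=
  ∫⁻ e, w x e * V (f x e) ∂κ

section

variable {S E : Type*} {f : S → E → S}
  {w : S → E → ℝ≥0∞} {V : S → ℝ≥0∞}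

theorem iterState_seqCons (f : S → E → S) (x : S) (e : E) (ω : ℕ → E) (n : ℕ) :
    iterState f x (seqCons (e, ω)) (n + 1) = iterState f (f x e) ω n := by
  induction n with
  | zero => rfl
  | succ n ih => rw [iterState, ih, iterState]; rfl

theorem measurable_iterState [MeasurableSpace S] [MeasurableSpace E] (hf : Measurable (Function.uncurry f)) (n : ℕ) :
    Measurable (fun p : S × (ℕ → E) => iterState f p.1 p.2 n) := by
  induction n with
  | zero => exact measurable_fst
  | succ n ih => exact hf.comp (ih.prodMk ((measurable_pi_apply n).comp measurable_snd))

theorem measurable_iterWeight [MeasurableSpace S] [MeasurableSpace E]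
    (hf : Measurable (Function.uncurry f))
    (hw : Measurable (Function.uncurry w)) (hV : Measurable V) (n : ℕ) :
    Measurable (fun p : S × (ℕ → E) =>
      (∏ i ∈ Finset.range n, w (iterState f p.1 p.2 i) (p.2 i)) * V (iterState f p.1 p.2 n)) := by
  refine Measurable.mul ?_ (hV.comp (measurable_iterState hf n))
  refine Finset.measurable_prod _ fun i _ => ?_
  exact hw.comp ((measurable_iterState hf i).prodMk ((measurable_pi_apply i).comp measurable_snd))

/-- Conditioning on the first entry restarts the recursion at `f x e`; hence the induction is over
all starting points at once. -/
theorem lintegral_iterWeight [MeasurableSpace S] [MeasurableSpace E] (κ : Measure E) [IsProbabilityMeasure κ]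
    (hf : Measurable (Function.uncurry f))
    (hw : Measurable (Function.uncurry w)) (hV : Measurable V) (n : ℕ) (x : S) :
    ∫⁻ ω, (∏ i ∈ Finset.range n, w (iterState f x ω i) (ω i)) * V (iterState f x ω n)
      ∂(Measure.infinitePi fun _ : ℕ => κ) = (weightedStep κ f w)^[n] V x := by
  induction n generalizing x with
  | zero => simp [iterState]
  | succ n ih =>
    have hm : ∀ n x, Measurable fun ω : ℕ → E =>
        (∏ i ∈ Finset.range n, w (iterState f x ω i) (ω i)) * V (iterState f x ω n) :=
      fun n x => (measurable_iterWeight hf hw hV n).comp measurable_prodMk_left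
    rw [← map_seqCons_infinitePi κ, lintegral_map (hm (n + 1) x) measurable_seqCons,
      Function.iterate_succ_apply']
    refine (lintegral_prod _ ((hm (n + 1) x).comp measurable_seqCons).aemeasurable).trans ?_
    refine lintegral_congr fun e => ?_
    rw [← ih, ← lintegral_const_mul _ (hm n _)]
    refine lintegral_congr fun ω => ?_
    simp only [Function.comp_apply]
    rw [Finset.prod_range_succ', iterState_seqCons]
    simp only [iterState_seqCons]
    rw [← mul_assoc, mul_comm (w x e)]
    rfl

/-- The martingale property of a harmonic `V`. The invariant set `I` allows for equations that hold
only on a half-line. -/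
theorem iterate_weightedStep_eq [MeasurableSpace E] {κ : Measure E} {I : Set S}
    (hI : ∀ x ∈ I, ∀ᵐ e ∂κ, f x e ∈ I) (h : ∀ x ∈ I, weightedStep κ f w V x = V x) (n : ℕ) :
    ∀ x ∈ I, (weightedStep κ f w)^[n] V x = V x := by
  induction n with
  | zero => simp
  | succ n ih =>
    intro x hx
    rw [Function.iterate_succ_apply', ← h x hx]
    refine lintegral_congr_ae ?_
    filter_upwards [hI x hx] with e he
    rw [ih _ he]

theorem iterate_weightedStep_le [MeasurableSpace E] {κ : Measure E} {I : Set S}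
    (hI : ∀ x ∈ I, ∀ᵐ e ∂κ, f x e ∈ I) (h : ∀ x ∈ I, weightedStep κ f w V x ≤ V x) (n : ℕ) :
    ∀ x ∈ I, (weightedStep κ f w)^[n] V x ≤ V x := by
  induction n with
  | zero => simp
  | succ n ih =>
    intro x hx
    rw [Function.iterate_succ_apply']
    refine le_trans (lintegral_mono_ae ?_) (h x hx)
    filter_upwards [hI x hx] with e he
    gcongr
    exact ih _ he

end

/-! ### Response functions, their inverses and the image of Lebesgue measure -/

/-- The image on `(0, ∞)` of Lebesgue measure on `(0, ∞)` under `h`. -/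
noncomputable def imageMeasure (h : ℝ → ℝ) : Measure ℝ :=
  Measure.map h (volume.restrict {u | 0 < u ∧ 0 < h u})

namespace IsResponse

variable {h : ℝ → ℝ}

theorem measurableSet_pos (hh : IsResponse h) : MeasurableSet {u | 0 < u ∧ 0 < h u} := by
  refine OrdConnected.measurableSet ⟨fun x hx y hy z hz => ?_⟩
  have hz0 : 0 < z := hx.1.trans_le hz.1
  exact ⟨hz0, hy.2.trans_le (hh.anti hz0 hy.1 hz.2)⟩

theorem aemeasurable_pos (hh : IsResponse h) :
    AEMeasurable h (volume.restrict {u | 0 < u ∧ 0 < h u}) :=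
  aemeasurable_restrict_of_antitoneOn hh.measurableSet_pos (hh.anti.mono fun _ hu => hu.1)

/-- `F 0 = 0` compensates for the omission of the zero set of `h`, which may have infinite length.
-/
theorem lintegral_imageMeasure (hh : IsResponse h) {F : ℝ → ℝ≥0∞} (hF : Measurable F)
    (hF0 : F 0 = 0) : ∫⁻ z, F z ∂(imageMeasure h) = ∫⁻ u in Ioi (0 : ℝ), F (h u) := by
  rw [imageMeasure, lintegral_map' hF.aemeasurable hh.aemeasurable_pos]
  have e : {u | 0 < u ∧ 0 < h u} = {u | 0 < u ∧ 0 < h u} ∩ Ioi 0 := by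
    ext u; simp only [mem_ofPred_eq, mem_inter_iff, mem_Ioi]; tauto
  rw [e, ← Measure.restrict_restrict hh.measurableSet_pos,
    ← lintegral_indicator hh.measurableSet_pos]
  refine setLIntegral_congr_fun measurableSet_Ioi fun u hu => ?_
  by_cases h0 : 0 < h u
  · rw [indicator_of_mem (show u ∈ {u | 0 < u ∧ 0 < h u} from ⟨hu, h0⟩)]
  · rw [indicator_of_notMem (fun hc => h0 hc.2), le_antisymm (not_lt.1 h0) (hh.nonneg u hu), hF0]

/-- The Galois connection behind all facts about the inverse; right-continuity is what makes the
infimum attained. -/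
theorem le_iff_genInv_le (hh : IsResponse h) {u x : ℝ} (hu : 0 < u) :
    h u ≤ x ↔ genInv h x ≤ ENNReal.ofReal u := by
  constructor
  · intro hx
    exact sInf_le ⟨u, ⟨hu, hx⟩, rfl⟩
  · intro hx
    have key : ∀ v, u < v → h v ≤ x := by
      intro v hv
      have : genInv h x < ENNReal.ofReal v :=
        hx.trans_lt ((ENNReal.ofReal_lt_ofReal_iff (hu.trans hv)).2 hv)
      obtain ⟨_, ⟨w, ⟨hw0, hw⟩, rfl⟩, hwv⟩ := sInf_lt_iff.1 this
      have hwv' : w < v := (ENNReal.ofReal_lt_ofReal_iff (hu.trans hv)).1 hwv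
      exact (hh.anti hw0 (hu.trans hv) hwv'.le).trans hw
    refine le_of_tendsto (hh.right_cont u hu) ?_
    filter_upwards [self_mem_nhdsWithin] with v hv using key v hv

theorem eqOn_of_genInv_eq {h' : ℝ → ℝ} (hh : IsResponse h) (hh' : IsResponse h')
    (he : ∀ x, 0 < x → genInv h' x = genInv h x) : EqOn h' h (Ioi 0) := by
  intro u hu
  have key : ∀ x, 0 < x → (h' u ≤ x ↔ h u ≤ x) := fun x hx => by
    rw [hh'.le_iff_genInv_le hu, hh.le_iff_genInv_le hu, he x hx]
  refine le_antisymm (le_of_forall_gt_imp_ge_of_dense fun x hx => ?_)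
    (le_of_forall_gt_imp_ge_of_dense fun x hx => ?_)
  · exact (key x ((hh.nonneg u hu).trans_lt hx)).2 hx.le
  · exact (key x ((hh'.nonneg u hu).trans_lt hx)).1 hx.le

/-- By the Galois connection the set where `h` exceeds `x` is the interval from 0 to `genInv h x`.
-/
theorem imageMeasure_Ioi (hh : IsResponse h) {x : ℝ} (hx : 0 < x) :
    imageMeasure h (Ioi x) = genInv h x := by
  rw [imageMeasure, Measure.map_apply_of_aemeasurable hh.aemeasurable_pos measurableSet_Ioi,
    Measure.restrict_apply' hh.measurableSet_pos]
  have e : h ⁻¹' Ioi x ∩ {u | 0 < u ∧ 0 < h u} = {u | 0 < u ∧ ENNReal.ofReal u < genInv h x} := by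
    ext u
    simp only [mem_inter_iff, mem_preimage, mem_Ioi, mem_ofPred_eq]
    constructor
    · rintro ⟨h1, h2, _⟩
      exact ⟨h2, not_le.1 fun hc => not_le.2 h1 ((hh.le_iff_genInv_le h2).2 hc)⟩
    · rintro ⟨h1, h2⟩
      have : x < h u := not_le.1 fun hc => not_le.2 h2 ((hh.le_iff_genInv_le h1).1 hc)
      exact ⟨this, h1, hx.trans this⟩
  rw [e]
  rcases eq_or_ne (genInv h x) ⊤ with ht | ht
  · rw [ht]
    have : {u : ℝ | 0 < u ∧ ENNReal.ofReal u < ⊤} = Ioi 0 := by ext u; simp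
    rw [this, Real.volume_Ioi]
  · have : {u : ℝ | 0 < u ∧ ENNReal.ofReal u < genInv h x} = Ioo 0 (genInv h x).toReal := by
      ext u
      simp only [mem_ofPred_eq, mem_Ioo]
      exact and_congr_right fun hu => ENNReal.ofReal_lt_iff_lt_toReal hu.le ht
    rw [this, Real.volume_Ioo, sub_zero, ENNReal.ofReal_toReal ht]

theorem imageMeasure_Iic (hh : IsResponse h) : imageMeasure h (Iic 0) = 0 := by
  rw [imageMeasure, Measure.map_apply_of_aemeasurable hh.aemeasurable_pos measurableSet_Iic,
    Measure.restrict_apply' hh.measurableSet_pos]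
  convert measure_empty (μ := volume)
  ext u
  simp only [mem_inter_iff, mem_preimage, mem_Iic, mem_ofPred_eq, mem_empty_iff_false, iff_false]
  rintro ⟨h1, _, h2⟩
  exact absurd h1 (not_le.2 h2)

/-- Markov's inequality for the image measure, whose first moment is ∫ h. -/
theorem genInv_lt_top (hh : IsResponse h)
    (hint : ∫⁻ z in Ioi (0 : ℝ), ENNReal.ofReal (h z) < ⊤) {x : ℝ} (hx : 0 < x) :
    genInv h x < ⊤ := by
  rw [← hh.imageMeasure_Ioi hx]
  rw [← hh.lintegral_imageMeasure ENNReal.measurable_ofReal ENNReal.ofReal_zero] at hint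
  have h1 := mul_meas_ge_le_lintegral (μ := imageMeasure h) ENNReal.measurable_ofReal
    (ENNReal.ofReal x)
  have h2 : imageMeasure h (Ioi x) ≤
      imageMeasure h {y | ENNReal.ofReal x ≤ ENNReal.ofReal y} :=
    measure_mono fun y hy => ENNReal.ofReal_le_ofReal (le_of_lt hy)
  have h3 : ENNReal.ofReal x ≠ 0 := by simpa using hx
  by_contra hc
  rw [not_lt, top_le_iff] at hc
  rw [hc, top_le_iff] at h2
  rw [h2, ENNReal.mul_top h3] at h1
  exact not_le.2 hint h1

theorem isNegStieltjes (hh : IsResponse h) (hfin : ∀ x, 0 < x → genInv h x < ⊤) :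
    IsNegStieltjes (genInv h) (imageMeasure h) where
  finite := hfin
  nonpos_null := hh.imageMeasure_Iic
  Ioc_eq x y hx hxy := by
    have hy := hx.trans_le hxy
    rw [← Ioi_sdiff_Ioi, measure_sdiff (Ioi_subset_Ioi hxy) nullMeasurableSet_Ioi,
      hh.imageMeasure_Ioi hx, hh.imageMeasure_Ioi hy]
    rw [hh.imageMeasure_Ioi hy]
    exact (hfin y hy).ne

/-- A measure on `(0, ∞)` whose tail is the inverse of `h` is the image measure of `h`. -/
theorem eq_imageMeasure (hh : IsResponse h) {κ : Measure ℝ} (hκ : κ (Iic 0) = 0)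
    (hfin : ∀ x, 0 < x → genInv h x < ⊤) (htail : ∀ x, 0 < x → genInv h x = κ (Ioi x)) :
    κ = imageMeasure h := by
  -- The measures may be infinite near 0, so they are compared on the sets (1/(n+1), ∞), where they
  -- are finite, and on (-∞, 0], where both vanish.
  let s : ℕ → Set ℝ := fun n => Nat.casesOn n (Iic 0) fun n => Ioi (1 / ((n : ℝ) + 1))
  have hs : ⋃ i, s i = univ := by
    refine eq_univ_of_forall fun x => mem_iUnion.2 ?_
    rcases le_or_gt x 0 with hx | hx
    · exact ⟨0, hx⟩
    · obtain ⟨n, hn⟩ := exists_nat_one_div_lt hx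
      exact ⟨n + 1, hn⟩
  refine (Measure.ext_iff_of_iUnion_eq_univ hs).2 fun i => ?_
  cases i with
  | zero =>
    change κ.restrict (Iic 0) = (imageMeasure h).restrict (Iic 0)
    rw [Measure.restrict_eq_zero.2 hκ, Measure.restrict_eq_zero.2 hh.imageMeasure_Iic]
  | succ n =>
    set ε : ℝ := 1 / ((n : ℝ) + 1) with hε
    have hε0 : 0 < ε := by positivity
    change κ.restrict (Ioi ε) = (imageMeasure h).restrict (Ioi ε)
    have ht : ∀ x, 0 < x → κ (Ioi x) = imageMeasure h (Ioi x) := fun x hx => by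
      rw [← htail x hx, hh.imageMeasure_Ioi hx]
    have hf : ∀ x, 0 < x → κ (Ioi x) ≠ ⊤ := fun x hx => by
      rw [← htail x hx]; exact (hfin x hx).ne
    have : IsFiniteMeasure (κ.restrict (Ioi ε)) :=
      ⟨by rw [Measure.restrict_apply_univ]; exact (hf ε hε0).lt_top⟩
    refine Measure.ext_of_Ioc _ _ fun a b hab => ?_
    rw [Measure.restrict_apply measurableSet_Ioc, Measure.restrict_apply measurableSet_Ioc]
    rcases le_total b (max a ε) with hb | hb
    · have : Ioc a b ∩ Ioi ε = ∅ := by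
        ext z
        simp only [mem_inter_iff, mem_Ioc, mem_Ioi, mem_empty_iff_false, iff_false]
        rintro ⟨⟨h1, h2⟩, h3⟩
        exact absurd (max_lt h1 h3) (not_lt.2 (h2.trans hb))
      rw [this, measure_empty, measure_empty]
    · have : Ioc a b ∩ Ioi ε = Ioi (max a ε) \ Ioi b := by
        ext z
        simp only [mem_inter_iff, mem_Ioc, mem_Ioi, Set.mem_sdiff, not_lt, max_lt_iff]; tauto
      have hm : 0 < max a ε := lt_max_of_lt_right hε0
      have hb0 : 0 < b := hm.trans_le hb
      rw [this, measure_sdiff (Ioi_subset_Ioi hb) nullMeasurableSet_Ioi (hf b hb0),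
        measure_sdiff (Ioi_subset_Ioi hb) nullMeasurableSet_Ioi (ht b hb0 ▸ hf b hb0),
        ht _ hm, ht b hb0]

end IsResponse

/-! ### The response function with a prescribed inverse -/

/-- The right-continuous inverse of the tail `x ↦ κ (x, ∞)`. -/
noncomputable def invTail (κ : Measure ℝ) (u : ℝ) : ℝ :=
  sInf {x | 0 < x ∧ κ (Ioi x) ≤ ENNReal.ofReal u}

section invTail

variable {κ : Measure ℝ}

theorem measure_Ioi_le_of_forall_gt {x : ℝ} {c : ℝ≥0∞} (h : ∀ y, x < y → κ (Ioi y) ≤ c) :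
    κ (Ioi x) ≤ c := by
  have e : Ioi x = ⋃ n : ℕ, Ioi (x + 1 / ((n : ℝ) + 1)) := by
    ext z
    simp only [mem_Ioi, mem_iUnion]
    constructor
    · intro hz
      obtain ⟨n, hn⟩ := exists_nat_one_div_lt (sub_pos.2 hz)
      exact ⟨n, by linarith⟩
    · rintro ⟨n, hn⟩
      have : (0 : ℝ) < 1 / ((n : ℝ) + 1) := by positivity
      linarith
  have hm : Monotone fun n : ℕ => Ioi (x + 1 / ((n : ℝ) + 1)) := by
    intro m n hmn
    refine Ioi_subset_Ioi ?_
    gcongr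
  rw [e, hm.measure_iUnion]
  refine iSup_le fun n => h _ ?_
  have : (0 : ℝ) < 1 / ((n : ℝ) + 1) := by positivity
  linarith

/-- The Galois connection for the tail, which is right-continuous by continuity of measure from
below. `hne` keeps the real infimum from being that of an empty set. -/
theorem invTail_le_iff (hne : ∀ u, 0 < u → ∃ x, 0 < x ∧ κ (Ioi x) ≤ ENNReal.ofReal u) {u x : ℝ}
    (hu : 0 < u) (hx : 0 < x) : invTail κ u ≤ x ↔ κ (Ioi x) ≤ ENNReal.ofReal u := by
  constructor
  · intro h
    refine measure_Ioi_le_of_forall_gt fun y hy => ?_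
    obtain ⟨z, ⟨_, hz⟩, hzy⟩ := (csInf_lt_iff ⟨0, fun z hz => hz.1.le⟩ (hne u hu)).1 (h.trans_lt hy)
    exact (measure_mono (Ioi_subset_Ioi hzy.le)).trans hz
  · intro h
    exact csInf_le ⟨0, fun z hz => hz.1.le⟩ ⟨hx, h⟩

theorem invTail_nonneg (κ : Measure ℝ) (u : ℝ) : 0 ≤ invTail κ u :=
  Real.sInf_nonneg fun _ hx => hx.1.le

theorem isResponse_invTail (hne : ∀ u, 0 < u → ∃ x, 0 < x ∧ κ (Ioi x) ≤ ENNReal.ofReal u) :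
    IsResponse (invTail κ) := by
  have hanti : AntitoneOn (invTail κ) (Ioi 0) := fun u hu v hv huv =>
    csInf_le_csInf ⟨0, fun z hz => hz.1.le⟩ (hne u hu)
      fun x hx => ⟨hx.1, hx.2.trans (ENNReal.ofReal_le_ofReal huv)⟩
  refine ⟨fun u _ => invTail_nonneg κ u, hanti, fun u hu => ?_⟩
  refine tendsto_order.2 ⟨fun x hx => ?_, fun x hx => ?_⟩
  · obtain ⟨y, hxy, hy⟩ := exists_between hx
    rcases le_or_gt y 0 with hy0 | hy0
    · exact Eventually.of_forall fun v => (hxy.trans_le hy0).trans_le (invTail_nonneg κ v)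
    · have h1 : ENNReal.ofReal u < κ (Ioi y) :=
        not_le.1 fun hc => not_le.2 hy ((invTail_le_iff hne hu hy0).2 hc)
      have h2 : ∀ᶠ v in 𝓝[>] u, ENNReal.ofReal v < κ (Ioi y) :=
        nhdsWithin_le_nhds (ENNReal.continuous_ofReal.continuousAt.eventually_lt_const h1)
      filter_upwards [h2, self_mem_nhdsWithin] with v hv hv'
      refine hxy.trans (not_le.1 fun hc => not_le.2 hv ?_)
      exact (invTail_le_iff hne (hu.trans hv') hy0).1 hc
  · filter_upwards [self_mem_nhdsWithin] with v hv
    exact (hanti hu (hu.trans hv) (le_of_lt hv)).trans_lt hx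

theorem genInv_invTail (hne : ∀ u, 0 < u → ∃ x, 0 < x ∧ κ (Ioi x) ≤ ENNReal.ofReal u) {x : ℝ}
    (hx : 0 < x) : genInv (invTail κ) x = κ (Ioi x) := by
  refine le_antisymm ?_ (le_sInf ?_)
  -- The tail at `x` may be 0, while `genInv` admits only positive arguments; adding ε repairs this.
  · refine ENNReal.le_of_forall_pos_le_add fun ε hε hlt => ?_
    have hpos : 0 < (κ (Ioi x)).toReal + ε := by positivity
    have e : κ (Ioi x) + ε = ENNReal.ofReal ((κ (Ioi x)).toReal + ε) := by
      rw [ENNReal.ofReal_add (by positivity) (by positivity), ENNReal.ofReal_toReal hlt.ne,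
        ENNReal.ofReal_coe_nnreal]
    rw [e]
    refine sInf_le ⟨_, ⟨hpos, (invTail_le_iff hne hpos hx).2 ?_⟩, rfl⟩
    rw [← e]
    exact le_self_add
  · rintro _ ⟨u, ⟨hu, hux⟩, rfl⟩
    exact (invTail_le_iff hne hu hx).1 hux

end invTail

/-! ### Laplace transforms of laws on the half-line -/

/-- The Laplace transform. -/
noncomputable def lap (μ : Measure ℝ) (s : ℝ) : ℝ := ∫ x, Real.exp (-(s * x)) ∂μ

namespace IsNonnegLaw

variable {μ : Measure ℝ}

theorem ae_nonneg (hμ : IsNonnegLaw μ) : ∀ᵐ x ∂μ, 0 ≤ x := by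
  filter_upwards [measure_eq_zero_iff_ae_notMem.1 hμ.neg_null] with x hx
  simpa using hx

theorem ae_norm_exp_le (hμ : IsNonnegLaw μ) {s : ℝ} (hs : 0 ≤ s) :
    ∀ᵐ x ∂μ, ‖Real.exp (-(s * x))‖ ≤ 1 := by
  filter_upwards [hμ.ae_nonneg] with x hx
  rw [Real.norm_eq_abs, Real.abs_exp, Real.exp_le_one_iff, neg_nonpos]
  positivity

theorem integrable_exp (hμ : IsNonnegLaw μ) {s : ℝ} (hs : 0 ≤ s) :
    Integrable (fun x => Real.exp (-(s * x))) μ := by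
  have := hμ.isProb
  exact Integrable.of_bound (by fun_prop) 1 (hμ.ae_norm_exp_le hs)

theorem lap_zero (hμ : IsNonnegLaw μ) : lap μ 0 = 1 := by
  have := hμ.isProb
  simp [lap]

theorem lap_pos (hμ : IsNonnegLaw μ) {s : ℝ} (hs : 0 ≤ s) : 0 < lap μ s := by
  have := hμ.isProb
  exact integral_exp_pos (hμ.integrable_exp hs)

theorem lap_anti (hμ : IsNonnegLaw μ) {s t : ℝ} (hs : 0 ≤ s) (hst : s ≤ t) :
    lap μ t ≤ lap μ s := by
  refine integral_mono_ae (hμ.integrable_exp (hs.trans hst)) (hμ.integrable_exp hs) ?_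
  filter_upwards [hμ.ae_nonneg] with x hx
  gcongr

theorem lap_le_one (hμ : IsNonnegLaw μ) {s : ℝ} (hs : 0 ≤ s) : lap μ s ≤ 1 :=
  hμ.lap_zero ▸ hμ.lap_anti le_rfl hs

theorem ofReal_lap (hμ : IsNonnegLaw μ) {s : ℝ} (hs : 0 ≤ s) :
    ENNReal.ofReal (lap μ s) = ∫⁻ x, ENNReal.ofReal (Real.exp (-(s * x))) ∂μ :=
  ofReal_integral_eq_lintegral_ofReal (hμ.integrable_exp hs) (.of_forall fun _ => (Real.exp_pos _).le)

theorem measurable_lap (hμ : IsNonnegLaw μ) : Measurable (lap μ) := by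
  have := hμ.isProb
  have : StronglyMeasurable (Function.uncurry fun s x : ℝ => Real.exp (-(s * x))) := by
    apply Measurable.stronglyMeasurable
    unfold Function.uncurry
    fun_prop
  exact this.integral_prod_right.measurable

theorem continuousOn_lap (hμ : IsNonnegLaw μ) : ContinuousOn (lap μ) (Ici 0) := by
  have := hμ.isProb
  refine continuousOn_of_dominated (bound := fun _ => 1) (fun s _ => by fun_prop)
    (fun s hs => hμ.ae_norm_exp_le hs) (integrable_const 1) ?_
  exact .of_forall fun x => by fun_prop

theorem one_sub_lap_eq (hμ : IsNonnegLaw μ) {s : ℝ} (hs : 0 ≤ s) :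
    ENNReal.ofReal (1 - lap μ s) = ∫⁻ x, ENNReal.ofReal (1 - Real.exp (-(s * x))) ∂μ := by
  have := hμ.isProb
  have hi : Integrable (fun x => 1 - Real.exp (-(s * x))) μ :=
    (integrable_const 1).sub (hμ.integrable_exp hs)
  have e : 1 - lap μ s = ∫ x, (1 - Real.exp (-(s * x))) ∂μ := by
    rw [integral_sub (integrable_const 1) (hμ.integrable_exp hs)]
    simp [lap]
  rw [e, ofReal_integral_eq_lintegral_ofReal hi]
  filter_upwards [hμ.ae_norm_exp_le hs] with x hx
  rw [Real.norm_eq_abs, Real.abs_exp] at hx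
  simpa using hx

end IsNonnegLaw

/-! ### A measurable extension of the response function, and the renewal equation -/

/-- The function `h` on `(0, ∞)`, extended by `0`. -/
noncomputable def extendZero (h : ℝ → ℝ) (u : ℝ) : ℝ := if 0 < u then h u else 0

theorem extendZero_of_pos (h : ℝ → ℝ) {u : ℝ} (hu : 0 < u) : extendZero h u = h u := if_pos hu

theorem extendZero_of_nonpos (h : ℝ → ℝ) {u : ℝ} (hu : u ≤ 0) : extendZero h u = 0 :=
  if_neg (not_lt.2 hu)

theorem IsResponse.extendZero_nonneg {h : ℝ → ℝ} (hh : IsResponse h) (u : ℝ) :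
    0 ≤ extendZero h u := by
  unfold extendZero
  split_ifs with hu
  · exact hh.nonneg u hu
  · exact le_rfl

theorem IsResponse.measurable_extendZero {h : ℝ → ℝ} (hh : IsResponse h) :
    Measurable (extendZero h) := by
  refine measurable_of_Ioi fun c => ?_
  rcases lt_or_ge c 0 with hc | hc
  · convert MeasurableSet.univ
    exact eq_univ_of_forall fun u => hc.trans_le (hh.extendZero_nonneg u)
  · refine OrdConnected.measurableSet ⟨fun x hx y hy z hz => ?_⟩
    have hpos : ∀ u, c < extendZero h u → 0 < u := fun u hu => by
      by_contra hc'
      rw [extendZero_of_nonpos h (not_lt.1 hc')] at hu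
      exact not_lt.2 hc hu
    have hx0 := hpos x hx
    have hy0 := hpos y hy
    have hz0 : 0 < z := hx0.trans_le hz.1
    simp only [mem_preimage, mem_Ioi] at hy ⊢
    rw [extendZero_of_pos h hy0] at hy
    rw [extendZero_of_pos h hz0]
    exact hy.trans_le (hh.anti hz0 hy0 hz.2)

/-- One-sided derivatives are all that is available, as `h` is only right-continuous. -/
theorem integral_Ioi_of_hasDerivWithinAt_right {f f' : ℝ → ℝ} {a m : ℝ}
    (hcont : ContinuousOn f (Ici a))
    (hderiv : ∀ x ∈ Ioi a, HasDerivWithinAt f (f' x) (Ioi x) x)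
    (hint : IntegrableOn f' (Ioi a)) (hf : Tendsto f atTop (𝓝 m)) :
    ∫ x in Ioi a, f' x = m - f a := by
  refine tendsto_nhds_unique (intervalIntegral_tendsto_integral_Ioi a hint tendsto_id) ?_
  refine Tendsto.congr' ?_ (hf.sub_const _)
  filter_upwards [Ioi_mem_atTop a] with x hx
  have hx' : a ≤ x := le_of_lt hx
  symm
  refine intervalIntegral.integral_eq_sub_of_hasDeriv_right_of_le hx'
    (hcont.mono Icc_subset_Ici_self) (fun y hy => hderiv y hy.1) ?_
  refine (intervalIntegrable_iff_integrableOn_Ioc_of_le hx').2 ?_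
  exact hint.mono_set Ioc_subset_Ioi_self

theorem lintegral_expMeasure (r : ℝ) {f : ℝ → ℝ≥0∞} (hf : Measurable f) :
    ∫⁻ e, f e ∂(expMeasure r) =
      ∫⁻ e in Ioi (0 : ℝ), ENNReal.ofReal (r * Real.exp (-(r * e))) * f e := by
  have hm : Measurable (exponentialPDF r) := (measurable_exponentialPDFReal r).ennreal_ofReal
  have : expMeasure r = volume.withDensity (exponentialPDF r) := rfl
  rw [this, lintegral_withDensity_eq_lintegral_mul _ hm hf, ← lintegral_indicator measurableSet_Ioi]
  refine lintegral_congr_ae ?_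
  have h0 : ∀ᵐ x : ℝ ∂volume, x ≠ 0 := by simp [ae_iff]
  filter_upwards [h0] with e he
  rcases lt_or_gt_of_ne he with h | h
  · rw [indicator_of_notMem (by simpa using h.le), Pi.mul_apply, exponentialPDF_of_neg h, zero_mul]
  · rw [indicator_of_mem (by simpa using h), Pi.mul_apply, exponentialPDF_of_nonneg h.le]

theorem ae_pos_expMeasure (r : ℝ) : ∀ᵐ e ∂(expMeasure r), 0 < e := by
  have h : expMeasure r (Iic 0) = 0 := by
    rw [← lintegral_indicator_one measurableSet_Iic,
      lintegral_expMeasure r (measurable_one.indicator measurableSet_Iic)]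
    rw [setLIntegral_congr_fun measurableSet_Ioi (g := fun _ => 0), lintegral_zero]
    intro e he
    simp only
    rw [indicator_of_notMem (by simpa using he), mul_zero]
  filter_upwards [measure_eq_zero_iff_ae_notMem.1 h] with x hx
  simpa using hx

section renewal

variable {G : ℝ → ℝ} {r : ℝ}

/-- The function `t ↦ exp (-r ∫_t^∞ G)`. -/
noncomputable def expTail (r : ℝ) (G : ℝ → ℝ) (t : ℝ) : ℝ :=
  Real.exp (-(r * ((∫ u in Ioi (0 : ℝ), G u) - ∫ u in (0 : ℝ)..t, G u)))

theorem expTail_zero (r : ℝ) (G : ℝ → ℝ) :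
    expTail r G 0 = Real.exp (-(r * ∫ u in Ioi (0 : ℝ), G u)) := by
  simp [expTail]

theorem continuous_expTail (hG : Integrable G) : Continuous (expTail r G) := by
  have : Continuous fun t => ∫ u in (0 : ℝ)..t, G u :=
    intervalIntegral.continuous_primitive (fun a b => hG.intervalIntegrable) 0
  unfold expTail
  fun_prop

theorem tendsto_expTail (hG : Integrable G) : Tendsto (expTail r G) atTop (𝓝 1) := by
  have h := intervalIntegral_tendsto_integral_Ioi 0 hG.integrableOn tendsto_id
  have h2 := ((h.const_sub (∫ u in Ioi (0 : ℝ), G u)).const_mul r).neg.rexp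
  unfold expTail
  simpa using h2

theorem expTail_le_one (hr : 0 ≤ r) (hG : Integrable G) (hG0 : ∀ u, 0 ≤ G u) {t : ℝ}
    (ht : 0 ≤ t) : expTail r G t ≤ 1 := by
  unfold expTail
  rw [Real.exp_le_one_iff, neg_nonpos]
  refine mul_nonneg hr (sub_nonneg.2 ?_)
  rw [intervalIntegral.integral_of_le ht]
  exact setIntegral_mono_set hG.integrableOn (.of_forall hG0) Ioc_subset_Ioi_self.eventuallyLE

theorem hasDerivWithinAt_expTail (hG : Integrable G) {t : ℝ} (hm : Measurable G)
    (hc : ContinuousWithinAt G (Ioi t) t) :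
    HasDerivWithinAt (expTail r G) (expTail r G t * (r * G t)) (Ioi t) t := by
  have h : HasDerivWithinAt (fun t => ∫ u in (0 : ℝ)..t, G u) (G t) (Ioi t) t :=
    (intervalIntegral.integral_hasDerivWithinAt_right hG.intervalIntegrable
      (s := Ici t) (t := Ioi t) ⟨univ, univ_mem, hm.aestronglyMeasurable⟩ hc).mono
      Ioi_subset_Ici_self
  have h2 := ((h.const_sub (∫ u in Ioi (0 : ℝ), G u)).const_mul r).neg.exp
  refine HasDerivWithinAt.congr_deriv (f := expTail r G) h2 ?_
  simp only [Pi.neg_apply, expTail]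
  ring

/-- With H = `expTail r G`, the integrand is the right derivative in e of -exp(-re) H(t + e), since
H' = r G H. Probabilistically, this decomposes the Laplace functional of the points after `t` at the
first of them. -/
theorem integral_renewal (hr : 0 < r) (hG : Integrable G) (hm : Measurable G)
    (hG0 : ∀ u, 0 ≤ G u) (hG1 : ∀ u, G u ≤ 1)
    (hc : ∀ t, 0 < t → ContinuousWithinAt G (Ioi t) t) {t : ℝ} (ht : 0 ≤ t) :
    IntegrableOn (fun e => r * Real.exp (-(r * e)) * ((1 - G (t + e)) * expTail r G (t + e)))
      (Ioi 0) ∧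
    ∫ e in Ioi (0 : ℝ), r * Real.exp (-(r * e)) * ((1 - G (t + e)) * expTail r G (t + e)) =
      expTail r G t := by
  have hcont := continuous_expTail (r := r) hG
  have hint : IntegrableOn
      (fun e => r * Real.exp (-(r * e)) * ((1 - G (t + e)) * expTail r G (t + e))) (Ioi 0) := by
    have h1 : IntegrableOn (fun e : ℝ => r * Real.exp (-(r * e))) (Ioi 0) := by
      have := (integrableOn_exp_mul_Ioi (neg_lt_zero.2 hr) 0).const_mul r
      simp only [neg_mul] at this
      exact this
    refine Integrable.mono' h1 ?_ ?_
    · exact (by fun_prop : Measurable fun e =>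
        r * Real.exp (-(r * e)) * ((1 - G (t + e)) * expTail r G (t + e))).aestronglyMeasurable
    · refine (ae_restrict_iff' measurableSet_Ioi).2 (.of_forall fun e he => ?_)
      have h2 : 0 ≤ 1 - G (t + e) := sub_nonneg.2 (hG1 _)
      have h3 : 0 < expTail r G (t + e) := Real.exp_pos _
      rw [Real.norm_of_nonneg (by positivity)]
      refine mul_le_of_le_one_right (by positivity) (mul_le_one₀ (by linarith [hG0 (t + e)]) h3.le ?_)
      exact expTail_le_one hr.le hG hG0 (add_nonneg ht (le_of_lt he))
  refine ⟨hint, ?_⟩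
  rw [integral_Ioi_of_hasDerivWithinAt_right (f := fun e => -(Real.exp (-(r * e)) *
    expTail r G (t + e))) (m := 0) (by fun_prop) ?_ hint ?_]
  · simp
  · intro e he
    have hte : 0 < t + e := add_pos_of_nonneg_of_pos ht he
    have h1 : HasDerivWithinAt (fun e => expTail r G (t + e))
        (expTail r G (t + e) * (r * G (t + e)) * 1) (Ioi e) e := by
      refine HasDerivWithinAt.comp (h := fun e => t + e) (h₂ := expTail r G) e
        (hasDerivWithinAt_expTail hG hm (hc _ hte))
        ((hasDerivWithinAt_id e _).const_add t) ?_
      intro x hx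
      simpa using hx
    have h2 : HasDerivWithinAt (fun e => Real.exp (-(r * e)))
        (Real.exp (-(r * e)) * -(r * 1)) (Ioi e) e :=
      ((hasDerivWithinAt_id e _).const_mul r).neg.exp
    refine (h2.mul h1).neg.congr_deriv ?_
    ring
  · have h1 : Tendsto (fun e : ℝ => Real.exp (-(r * e))) atTop (𝓝 0) :=
      Real.tendsto_exp_neg_atTop_nhds_zero.comp (tendsto_id.const_mul_atTop hr)
    have h2 := (tendsto_expTail (r := r) hG).comp (tendsto_atTop_add_const_left atTop t tendsto_id)
    simpa using (h1.mul h2).neg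

end renewal

/-! ### The Poisson flow and its Laplace functional -/

/-- One arrival of the Poisson flow. -/
def flowStep (t : ℝ) (p : ℝ × ℝ) : ℝ := t + p.2

theorem measurable_flowStep : Measurable (Function.uncurry flowStep) := by
  unfold Function.uncurry flowStep
  fun_prop

theorem iterState_flowStep (ω : ℕ → ℝ × ℝ) (n : ℕ) :
    iterState flowStep 0 ω n = ∑ j ∈ Finset.range n, (ω j).2 := by
  induction n with
  | zero => rfl
  | succ n ih => rw [iterState, ih, Finset.sum_range_succ]; rfl

theorem iterState_flowStep_succ (ω : ℕ → ℝ × ℝ) (n : ℕ) :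
    iterState flowStep 0 ω (n + 1) = poissonPoint ω n := by
  rw [iterState_flowStep, poissonPoint]

theorem measurable_poissonPoint (i : ℕ) : Measurable fun ω : ℕ → ℝ × ℝ => poissonPoint ω i := by
  unfold poissonPoint
  fun_prop

theorem ae_shotNoiseBase {μ : Measure ℝ} {r : ℝ} (hr : 0 < r) (hμ : IsNonnegLaw μ) :
    ∀ᵐ ω ∂(shotNoiseBase r μ), ∀ i, 0 ≤ (ω i).1 ∧ 0 < (ω i).2 := by
  have := hμ.isProb
  have := isProbabilityMeasure_expMeasure hr
  have h : ∀ᵐ p ∂(μ.prod (expMeasure r)), 0 ≤ p.1 ∧ 0 < p.2 := by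
    have h1 : ∀ᵐ p ∂(μ.prod (expMeasure r)), 0 ≤ p.1 :=
      Measure.quasiMeasurePreserving_fst.ae hμ.ae_nonneg
    have h2 : ∀ᵐ p ∂(μ.prod (expMeasure r)), 0 < p.2 :=
      Measure.quasiMeasurePreserving_snd.ae (ae_pos_expMeasure r)
    filter_upwards [h1, h2] with p hp1 hp2 using ⟨hp1, hp2⟩
  rw [ae_all_iff]
  intro i
  exact (measurePreserving_eval_infinitePi (fun _ : ℕ => μ.prod (expMeasure r)) i
    ).quasiMeasurePreserving.ae h

theorem isProbabilityMeasure_shotNoiseBase {μ : Measure ℝ} {r : ℝ} (hr : 0 < r)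
    (hμ : IsNonnegLaw μ) : IsProbabilityMeasure (shotNoiseBase r μ) := by
  have := hμ.isProb
  have := isProbabilityMeasure_expMeasure hr
  unfold shotNoiseBase
  infer_instance

theorem poissonPoint_pos {ω : ℕ → ℝ × ℝ} (h : ∀ i, 0 ≤ (ω i).1 ∧ 0 < (ω i).2) (i : ℕ) :
    0 < poissonPoint ω i :=
  Finset.sum_pos (fun j _ => (h j).2) ⟨0, by simp⟩

/-- The points of the Poisson flow tend to infinity. -/
theorem tendsto_sum_gaps {μ : Measure ℝ} {r : ℝ} (hr : 0 < r) (hμ : IsNonnegLaw μ) :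
    ∀ᵐ ω ∂(shotNoiseBase r μ),
      Tendsto (fun n => ∑ j ∈ Finset.range n, (ω j).2) atTop atTop := by
  have := hμ.isProb
  have := isProbabilityMeasure_expMeasure hr
  -- With these weights E exp(-τ_n) = q ^ n for some q < 1. The sum over n is integrable, so
  -- exp(-τ_n) tends to 0 almost surely.
  let w : ℝ → ℝ × ℝ → ℝ≥0∞ := fun _ p => ENNReal.ofReal (Real.exp (-p.2))
  have hw : Measurable (Function.uncurry w) := by
    simp only [w, Function.uncurry_def]
    fun_prop
  set q : ℝ≥0∞ := ∫⁻ p, ENNReal.ofReal (Real.exp (-p.2)) ∂(μ.prod (expMeasure r)) with hq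
  have hle : ∀ᵐ p ∂(μ.prod (expMeasure r)), ENNReal.ofReal (Real.exp (-p.2)) < 1 := by
    have h2 : ∀ᵐ p ∂(μ.prod (expMeasure r)), 0 < p.2 :=
      Measure.quasiMeasurePreserving_snd.ae (ae_pos_expMeasure r)
    filter_upwards [h2] with p hp
    rw [ENNReal.ofReal_lt_one, Real.exp_lt_one_iff]
    linarith
  have hq1 : q < 1 := by
    have h1 : (∫⁻ _, 1 ∂(μ.prod (expMeasure r)) : ℝ≥0∞) = 1 := by simp
    rw [← h1]
    refine lintegral_strict_mono (IsProbabilityMeasure.ne_zero _) (by fun_prop) ?_ hle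
    refine ne_top_of_le_ne_top ENNReal.one_ne_top ?_
    rw [← h1]
    exact lintegral_mono_ae (hle.mono fun _ h => h.le)
  have hiter : ∀ n x, (weightedStep (μ.prod (expMeasure r)) flowStep w)^[n] (fun _ => 1) x =
      q ^ n := by
    intro n
    induction n with
    | zero => simp
    | succ n ih =>
      intro x
      rw [Function.iterate_succ_apply', weightedStep]
      simp only [ih]
      rw [lintegral_mul_const _ (by simp only [w]; fun_prop), pow_succ, mul_comm]
  have hexp : ∀ n, ∫⁻ ω, ENNReal.ofReal (Real.exp (-∑ j ∈ Finset.range n, (ω j).2))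
      ∂(shotNoiseBase r μ) = q ^ n := by
    intro n
    rw [← hiter n 0, ← lintegral_iterWeight (μ.prod (expMeasure r)) measurable_flowStep hw
      measurable_const n 0]
    refine lintegral_congr fun ω => ?_
    simp only [w, mul_one]
    rw [← ENNReal.ofReal_prod_of_nonneg (fun _ _ => (Real.exp_pos _).le), ← Real.exp_sum,
      Finset.sum_neg_distrib]
  have hme : ∀ n, Measurable fun ω : ℕ → ℝ × ℝ =>
      ENNReal.ofReal (Real.exp (-∑ j ∈ Finset.range n, (ω j).2)) := fun n => by fun_prop
  have hsum : ∫⁻ ω, ∑' n, ENNReal.ofReal (Real.exp (-∑ j ∈ Finset.range n, (ω j).2))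
      ∂(shotNoiseBase r μ) ≠ ⊤ := by
    rw [lintegral_tsum (fun n => (hme n).aemeasurable)]
    simp only [hexp]
    rw [ENNReal.tsum_geometric]
    exact ENNReal.inv_ne_top.2 (tsub_pos_of_lt hq1).ne'
  filter_upwards [ae_lt_top (Measurable.tsum hme) hsum] with ω hω
  have h0 := ENNReal.tendsto_atTop_zero_of_tsum_ne_top hω.ne
  have h1 := (ENNReal.tendsto_toReal ENNReal.zero_ne_top).comp h0
  simp only [Function.comp_def, ENNReal.toReal_ofReal (Real.exp_pos _).le, ENNReal.toReal_zero]
    at h1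
  exact tendsto_neg_atBot_iff.1 (Real.tendsto_exp_comp_nhds_zero.1 h1)

section

variable {h : ℝ → ℝ} {r : ℝ} {μ : Measure ℝ}

/-- The link between the domain condition, stated with min(1, x), and the Laplace exponent. -/
theorem one_sub_exp_neg_le {s x : ℝ} (hx : 0 ≤ x) :
    1 - Real.exp (-(s * x)) ≤ max 1 s * min 1 x := by
  have h1 : 1 - Real.exp (-(s * x)) ≤ 1 := by linarith [Real.exp_pos (-(s * x))]
  have h2 : 1 - Real.exp (-(s * x)) ≤ s * x := by linarith [Real.add_one_le_exp (-(s * x))]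
  rcases le_total 1 x with hx1 | hx1
  · rw [min_eq_left hx1, mul_one]
    exact h1.trans (le_max_left _ _)
  · rw [min_eq_right hx1]
    exact h2.trans (mul_le_mul_of_nonneg_right (le_max_right _ _) hx)

/-- The function `1 - φ (s h (u))` for the Laplace transform `φ` of `μ`. -/
noncomputable def shotDefect (h : ℝ → ℝ) (μ : Measure ℝ) (s u : ℝ) : ℝ :=
  1 - lap μ (s * extendZero h u)

theorem shotDefect_nonneg (hh : IsResponse h) (hμ : IsNonnegLaw μ) {s : ℝ} (hs : 0 ≤ s) (u : ℝ) :
    0 ≤ shotDefect h μ s u :=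
  sub_nonneg.2 (hμ.lap_le_one (mul_nonneg hs (hh.extendZero_nonneg u)))

theorem shotDefect_le_one (hh : IsResponse h) (hμ : IsNonnegLaw μ) {s : ℝ} (hs : 0 ≤ s) (u : ℝ) :
    shotDefect h μ s u ≤ 1 :=
  sub_le_self _ (hμ.lap_pos (mul_nonneg hs (hh.extendZero_nonneg u))).le

theorem shotDefect_mono (hh : IsResponse h) (hμ : IsNonnegLaw μ) {s t : ℝ} (hs : 0 ≤ s)
    (hst : s ≤ t) (u : ℝ) : shotDefect h μ s u ≤ shotDefect h μ t u :=
  sub_le_sub_left (hμ.lap_anti (mul_nonneg hs (hh.extendZero_nonneg u))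
    (mul_le_mul_of_nonneg_right hst (hh.extendZero_nonneg u))) _

theorem measurable_shotDefect (hh : IsResponse h) (hμ : IsNonnegLaw μ) (s : ℝ) :
    Measurable (shotDefect h μ s) :=
  (hμ.measurable_lap.comp (hh.measurable_extendZero.const_mul s)).const_sub 1

theorem integrable_shotDefect (hh : IsResponse h) (hd : InShotNoiseDomain h μ) {s : ℝ}
    (hs : 0 ≤ s) : Integrable (shotDefect h μ s) := by
  have hμ := hd.1
  have := hμ.isProb
  have hm := measurable_shotDefect hh hμ s
  refine ⟨hm.aestronglyMeasurable, ?_⟩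
  rw [hasFiniteIntegral_iff_ofReal (.of_forall (shotDefect_nonneg hh hμ hs))]
  have hmz := hh.measurable_extendZero
  have key : ∀ u, ENNReal.ofReal (shotDefect h μ s u) ≤ ENNReal.ofReal (max 1 s) *
      ∫⁻ y, ENNReal.ofReal (min 1 (extendZero h u * y)) ∂μ := by
    intro u
    rw [shotDefect, hμ.one_sub_lap_eq (mul_nonneg hs (hh.extendZero_nonneg u)),
      ← lintegral_const_mul _ (by fun_prop)]
    refine lintegral_mono_ae ?_
    filter_upwards [hμ.ae_nonneg] with y hy
    rw [← ENNReal.ofReal_mul (by positivity), mul_assoc]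
    exact ENNReal.ofReal_le_ofReal
      (one_sub_exp_neg_le (mul_nonneg (hh.extendZero_nonneg u) hy))
  refine (lintegral_mono key).trans_lt ?_
  rw [lintegral_const_mul']
  swap
  · exact ENNReal.ofReal_ne_top
  refine ENNReal.mul_lt_top ENNReal.ofReal_lt_top ?_
  rw [lintegral_lintegral_swap (by fun_prop)]
  refine lt_of_eq_of_lt (lintegral_congr fun y => ?_) hd.2
  rw [← lintegral_indicator measurableSet_Ioi]
  refine lintegral_congr fun u => ?_
  by_cases hu : 0 < u
  · rw [indicator_of_mem (by simpa using hu), extendZero_of_pos h hu]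
  · rw [indicator_of_notMem (by simpa using hu), extendZero_of_nonpos h (not_lt.1 hu)]
    simp

theorem shotDefect_right_cont (hh : IsResponse h) (hμ : IsNonnegLaw μ) {s : ℝ} (hs : 0 ≤ s)
    {t : ℝ} (ht : 0 < t) : ContinuousWithinAt (shotDefect h μ s) (Ioi t) t := by
  have h1 : ContinuousWithinAt (extendZero h) (Ioi t) t := by
    refine (hh.right_cont t ht).congr (fun u hu => extendZero_of_pos h (ht.trans hu))
      (extendZero_of_pos h ht)
  have h2 : ContinuousWithinAt (fun u => s * extendZero h u) (Ioi t) t := h1.const_mul s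
  refine continuousWithinAt_const.sub ?_
  exact ContinuousWithinAt.comp (f := fun u => s * extendZero h u) (g := lap μ)
    (hμ.continuousOn_lap _ (mul_nonneg hs (hh.extendZero_nonneg t))) h2
    fun u _ => mul_nonneg hs (hh.extendZero_nonneg u)

/-- The weight of one arrival in the Laplace functional. -/
noncomputable def shotWeight (h : ℝ → ℝ) (s t : ℝ) (p : ℝ × ℝ) : ℝ≥0∞ :=
  ENNReal.ofReal (Real.exp (-(s * (p.1 * extendZero h (t + p.2)))))

theorem measurable_shotWeight (hh : IsResponse h) (s : ℝ) :
    Measurable (Function.uncurry (shotWeight h s)) := by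
  have := hh.measurable_extendZero
  simp only [Function.uncurry_def, shotWeight]
  fun_prop

/-- Averaging over the mark turns the weight of an arrival at time t + e into 1 - G(t + e), where G
is the defect; the renewal equation then says that `expTail` is harmonic. -/
theorem weightedStep_shotWeight (hh : IsResponse h) (hr : 0 < r) (hd : InShotNoiseDomain h μ)
    {s : ℝ} (hs : 0 ≤ s) {t : ℝ} (ht : 0 ≤ t) :
    weightedStep (μ.prod (expMeasure r)) flowStep (shotWeight h s)
      (fun t => ENNReal.ofReal (expTail r (shotDefect h μ s) t)) t =
      ENNReal.ofReal (expTail r (shotDefect h μ s) t) := by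
  have hμ := hd.1
  have := hμ.isProb
  have := isProbabilityMeasure_expMeasure hr
  have hG := integrable_shotDefect hh hd hs
  have hcont := continuous_expTail (r := r) hG
  have hmz := hh.measurable_extendZero
  have hmG := measurable_shotDefect hh hμ s
  have hren := integral_renewal hr hG hmG (shotDefect_nonneg hh hμ hs)
    (shotDefect_le_one hh hμ hs) (fun t ht => shotDefect_right_cont hh hμ hs ht) ht
  rw [weightedStep, lintegral_prod_symm]
  swap
  · simp only [shotWeight, flowStep]
    fun_prop
  have e1 : ∀ e, ∫⁻ y, shotWeight h s t (y, e) *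
      ENNReal.ofReal (expTail r (shotDefect h μ s) (flowStep t (y, e))) ∂μ =
      ENNReal.ofReal ((1 - shotDefect h μ s (t + e)) * expTail r (shotDefect h μ s) (t + e)) := by
    intro e
    simp only [shotWeight, flowStep]
    rw [lintegral_mul_const _ (by fun_prop), ENNReal.ofReal_mul
      (sub_nonneg.2 (shotDefect_le_one hh hμ hs _)), shotDefect, sub_sub_cancel,
      hμ.ofReal_lap (mul_nonneg hs (hh.extendZero_nonneg _))]
    congr 1
    refine lintegral_congr fun y => ?_
    congr 3
    ring
  simp only [e1]
  rw [lintegral_expMeasure r (by fun_prop)]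
  conv_rhs => rw [← hren.2]
  rw [ofReal_integral_eq_lintegral_ofReal hren.1]
  · refine lintegral_congr fun e => ?_
    rw [← ENNReal.ofReal_mul (by positivity)]
  · refine .of_forall fun e => ?_
    have h1 := sub_nonneg.2 (shotDefect_le_one hh hμ hs (t + e))
    have h2 : 0 < expTail r (shotDefect h μ s) (t + e) := Real.exp_pos _
    simp only [Pi.zero_apply]
    positivity

theorem lintegral_partial_laplace (hh : IsResponse h) (hr : 0 < r) (hd : InShotNoiseDomain h μ)
    {s : ℝ} (hs : 0 ≤ s) (n : ℕ) :
    ∫⁻ ω, ENNReal.ofReal (Real.exp (-(s * ∑ i ∈ Finset.range n,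
        (ω i).1 * extendZero h (poissonPoint ω i)))) *
      ENNReal.ofReal (expTail r (shotDefect h μ s) (∑ j ∈ Finset.range n, (ω j).2))
      ∂(shotNoiseBase r μ) = ENNReal.ofReal (expTail r (shotDefect h μ s) 0) := by
  have hμ := hd.1
  have := hμ.isProb
  have := isProbabilityMeasure_expMeasure hr
  have hI : ∀ x ∈ Ici (0 : ℝ), ∀ᵐ p ∂(μ.prod (expMeasure r)), flowStep x p ∈ Ici (0 : ℝ) := by
    intro x hx
    have h2 : ∀ᵐ p ∂(μ.prod (expMeasure r)), 0 < p.2 :=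
      Measure.quasiMeasurePreserving_snd.ae (ae_pos_expMeasure r)
    filter_upwards [h2] with p hp using add_nonneg hx hp.le
  rw [← iterate_weightedStep_eq hI (fun t ht => weightedStep_shotWeight hh hr hd hs ht) n 0
    (mem_Ici.2 le_rfl), ← lintegral_iterWeight _ measurable_flowStep (measurable_shotWeight hh s)
    (continuous_expTail (integrable_shotDefect hh hd hs)).measurable.ennreal_ofReal n 0]
  refine lintegral_congr fun ω => ?_
  rw [iterState_flowStep]
  congr 1
  simp only [shotWeight]
  rw [← ENNReal.ofReal_prod_of_nonneg (fun _ _ => (Real.exp_pos _).le), ← Real.exp_sum,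
    Finset.sum_neg_distrib, ← Finset.mul_sum]
  congr 4
  refine Finset.sum_congr rfl fun i _ => ?_
  -- `poissonPoint ω i` is state i + 1 of the flow: weight i is evaluated after its own gap has been
  -- added.
  rw [← iterState_flowStep_succ, iterState]
  rfl

end

/-! ### Convergence of the shot noise and its Laplace transform -/

section

variable {h : ℝ → ℝ} {r : ℝ} {μ : Measure ℝ}

/-- The summands of the shot noise. -/
noncomputable def shotTerm (h : ℝ → ℝ) (ω : ℕ → ℝ × ℝ) (i : ℕ) : ℝ :=
  (ω i).1 * extendZero h (poissonPoint ω i)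

theorem measurable_shotTerm (hh : IsResponse h) (i : ℕ) : Measurable fun ω => shotTerm h ω i := by
  have h1 := hh.measurable_extendZero
  have h2 := measurable_poissonPoint i
  unfold shotTerm
  fun_prop

theorem shotTerm_nonneg (hh : IsResponse h) {ω : ℕ → ℝ × ℝ} (hω : ∀ i, 0 ≤ (ω i).1 ∧ 0 < (ω i).2)
    (i : ℕ) : 0 ≤ shotTerm h ω i :=
  mul_nonneg (hω i).1 (hh.extendZero_nonneg _)

open Classical in
/-- `exp (-s ∑ a i)`, understood as zero if the sum diverges. -/
noncomputable def expNegSum (a : ℕ → ℝ) (s : ℝ) : ℝ :=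
  if Summable a then Real.exp (-(s * ∑' i, a i)) else 0

theorem tendsto_expNegSum {a : ℕ → ℝ} (ha : ∀ i, 0 ≤ a i) {s : ℝ} (hs : 0 < s) :
    Tendsto (fun n => Real.exp (-(s * ∑ i ∈ Finset.range n, a i))) atTop (𝓝 (expNegSum a s)) := by
  unfold expNegSum
  split_ifs with h
  · exact ((h.hasSum.tendsto_sum_nat.const_mul s).neg).rexp
  · have h1 := (not_summable_iff_tendsto_nat_atTop_of_nonneg ha).1 h
    exact Real.tendsto_exp_neg_atTop_nhds_zero.comp (h1.const_mul_atTop hs)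

/-- Dominated convergence in `lintegral_partial_laplace`: `expTail` tends to 1 along the points.
Convergence of the series is not yet known, so divergent ones contribute 0. -/
theorem lintegral_expNegSum (hh : IsResponse h) (hr : 0 < r) (hd : InShotNoiseDomain h μ)
    {s : ℝ} (hs : 0 < s) :
    ∫⁻ ω, ENNReal.ofReal (expNegSum (shotTerm h ω) s) ∂(shotNoiseBase r μ) =
      ENNReal.ofReal (Real.exp (-(r * ∫ u in Ioi (0 : ℝ), shotDefect h μ s u))) := by
  have hμ := hd.1
  have hP := isProbabilityMeasure_shotNoiseBase hr hμ
  have hG := integrable_shotDefect hh hd hs.le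
  have hG0 := shotDefect_nonneg hh hμ hs.le
  have hmt := measurable_shotTerm hh
  have hcont := continuous_expTail (r := r) hG
  rw [← expTail_zero]
  refine tendsto_nhds_unique (f := fun n : ℕ => ∫⁻ ω, ENNReal.ofReal (Real.exp (-(s *
      ∑ i ∈ Finset.range n, shotTerm h ω i))) *
    ENNReal.ofReal (expTail r (shotDefect h μ s) (∑ j ∈ Finset.range n, (ω j).2))
      ∂(shotNoiseBase r μ)) (l := atTop) ?_ ?_
  · refine tendsto_lintegral_of_dominated_convergence (fun _ => 1) (fun n => ?_) (fun n => ?_)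
      (by simp) ?_
    · fun_prop
    · filter_upwards [ae_shotNoiseBase hr hμ] with ω hω
      refine mul_le_one' ?_ ?_
      · rw [ENNReal.ofReal_le_one, Real.exp_le_one_iff, neg_nonpos]
        exact mul_nonneg hs.le (Finset.sum_nonneg fun i _ => shotTerm_nonneg hh hω i)
      · rw [ENNReal.ofReal_le_one]
        exact expTail_le_one hr.le hG hG0 (Finset.sum_nonneg fun i _ => (hω i).2.le)
    · filter_upwards [ae_shotNoiseBase hr hμ, tendsto_sum_gaps hr hμ] with ω hω hgap
      have h1 := tendsto_expNegSum (shotTerm_nonneg hh hω) hs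
      have h2 := (tendsto_expTail (r := r) hG).comp hgap
      have h3 := ENNReal.tendsto_ofReal (h1.mul h2)
      rw [mul_one] at h3
      refine h3.congr fun n => ?_
      rw [ENNReal.ofReal_mul (Real.exp_pos _).le]
      rfl
  · refine tendsto_const_nhds.congr fun n => ?_
    exact (lintegral_partial_laplace hh hr hd hs.le n).symm

theorem tendsto_integral_shotDefect (hh : IsResponse h) (hd : InShotNoiseDomain h μ) :
    Tendsto (fun n : ℕ => ∫ u in Ioi (0 : ℝ), shotDefect h μ (1 / ((n : ℝ) + 1)) u) atTop
      (𝓝 0) := by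
  have hμ := hd.1
  have hs : ∀ n : ℕ, (0 : ℝ) ≤ 1 / ((n : ℝ) + 1) := fun n => by positivity
  have hs1 : ∀ n : ℕ, 1 / ((n : ℝ) + 1) ≤ 1 := fun n =>
    (div_le_one (by positivity)).2 (by linarith [Nat.cast_nonneg (α := ℝ) n])
  suffices hc : Tendsto (fun n : ℕ => ∫ u in Ioi (0 : ℝ), shotDefect h μ (1 / ((n : ℝ) + 1)) u)
      atTop (𝓝 (∫ _ in Ioi (0 : ℝ), (0 : ℝ))) by simpa using hc
  refine tendsto_integral_of_dominated_convergence (shotDefect h μ 1)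
    (fun n => (measurable_shotDefect hh hμ _).aestronglyMeasurable)
    (integrable_shotDefect hh hd zero_le_one).integrableOn (fun n => .of_forall fun u => ?_)
    (.of_forall fun u => ?_)
  · rw [Real.norm_of_nonneg (shotDefect_nonneg hh hμ (hs n) u)]
    exact shotDefect_mono hh hμ (hs n) (hs1 n) u
  · have h1 : Tendsto (fun n : ℕ => 1 / ((n : ℝ) + 1) * extendZero h u) atTop (𝓝[≥] 0) := by
      refine tendsto_nhdsWithin_iff.2 ⟨?_, .of_forall fun n =>
        mul_nonneg (hs n) (hh.extendZero_nonneg u)⟩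
      simpa using (tendsto_one_div_add_atTop_nhds_zero_nat (𝕜 := ℝ)).mul_const (extendZero h u)
    have h2 := (hμ.continuousOn_lap 0 (mem_Ici.2 le_rfl)).tendsto.comp h1
    rw [hμ.lap_zero] at h2
    simp only [shotDefect]
    simpa using h2.const_sub 1

/-- The Laplace functional at `s` is a lower bound for the probability of convergence, and it tends
to 1 as `s` decreases to 0. -/
theorem ae_summable_shotTerm (hh : IsResponse h) (hr : 0 < r) (hd : InShotNoiseDomain h μ) :
    ∀ᵐ ω ∂(shotNoiseBase r μ), Summable (shotTerm h ω) := by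
  have hμ := hd.1
  have hP := isProbabilityMeasure_shotNoiseBase hr hμ
  have hmt := measurable_shotTerm hh
  -- The extended sum is measurable without any convergence and detects summability as finiteness.
  let Z : (ℕ → ℝ × ℝ) → ℝ≥0∞ := fun ω => ∑' i, ENNReal.ofReal (shotTerm h ω i)
  have hZ : Measurable Z := Measurable.tsum fun i => (hmt i).ennreal_ofReal
  have hiff : ∀ᵐ ω ∂(shotNoiseBase r μ), Summable (shotTerm h ω) ↔ Z ω ≠ ⊤ := by
    filter_upwards [ae_shotNoiseBase hr hμ] with ω hω
    exact ⟨fun hc => hc.tsum_ofReal_ne_top, fun hc => by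
      have := ENNReal.summable_toReal hc
      simpa only [ENNReal.toReal_ofReal (shotTerm_nonneg hh hω _)] using this⟩
  have hmS : MeasurableSet {ω | Z ω ≠ ⊤} := hZ (measurableSet_singleton _).compl
  have hlow : ∀ n : ℕ, ENNReal.ofReal (Real.exp (-(r * ∫ u in Ioi (0 : ℝ),
      shotDefect h μ (1 / ((n : ℝ) + 1)) u))) ≤ shotNoiseBase r μ {ω | Z ω ≠ ⊤} := by
    intro n
    have hn : (0 : ℝ) < 1 / ((n : ℝ) + 1) := by positivity
    rw [← lintegral_expNegSum hh hr hd hn, ← lintegral_indicator_one hmS]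
    refine lintegral_mono_ae ?_
    filter_upwards [hiff, ae_shotNoiseBase hr hμ] with ω h1 hω
    by_cases hs : Summable (shotTerm h ω)
    · rw [indicator_of_mem (show ω ∈ {ω | Z ω ≠ ⊤} from h1.1 hs), Pi.one_apply,
        ENNReal.ofReal_le_one, expNegSum, if_pos hs, Real.exp_le_one_iff, neg_nonpos]
      exact mul_nonneg hn.le (tsum_nonneg (shotTerm_nonneg hh hω))
    · rw [expNegSum, if_neg hs, ENNReal.ofReal_zero]
      exact zero_le
  have hlim : Tendsto (fun n : ℕ => ENNReal.ofReal (Real.exp (-(r * ∫ u in Ioi (0 : ℝ),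
      shotDefect h μ (1 / ((n : ℝ) + 1)) u)))) atTop (𝓝 1) := by
    have := ENNReal.tendsto_ofReal ((tendsto_integral_shotDefect hh hd).const_mul r).neg.rexp
    simpa using this
  have h1 : shotNoiseBase r μ {ω | Z ω ≠ ⊤} = 1 :=
    le_antisymm prob_le_one (le_of_tendsto' hlim hlow)
  have h2 : ∀ᵐ ω ∂(shotNoiseBase r μ), ω ∈ {ω | Z ω ≠ ⊤} := (mem_ae_iff_prob_eq_one hmS).2 h1
  filter_upwards [hiff, h2] with ω h3 h4 using h3.2 h4

theorem ae_shotNoise_eq (hr : 0 < r) (hμ : IsNonnegLaw μ) :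
    ∀ᵐ ω ∂(shotNoiseBase r μ), ∑' i, (ω i).1 * h (poissonPoint ω i) = ∑' i, shotTerm h ω i := by
  filter_upwards [ae_shotNoiseBase hr hμ] with ω hω
  refine tsum_congr fun i => ?_
  rw [shotTerm, extendZero_of_pos h (poissonPoint_pos hω i)]

theorem aemeasurable_shotNoise (hh : IsResponse h) (hr : 0 < r) (hμ : IsNonnegLaw μ) :
    AEMeasurable (fun ω => ∑' i, (ω i).1 * h (poissonPoint ω i)) (shotNoiseBase r μ) := by
  have hmt := measurable_shotTerm hh
  refine ⟨fun ω => (∑' i, ENNReal.ofReal (shotTerm h ω i)).toReal,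
    (Measurable.tsum fun i => (hmt i).ennreal_ofReal).ennreal_toReal, ?_⟩
  filter_upwards [ae_shotNoise_eq (h := h) hr hμ, ae_shotNoiseBase hr hμ] with ω h1 hω
  rw [h1, ENNReal.tsum_toReal_eq (fun _ => ENNReal.ofReal_ne_top)]
  exact tsum_congr fun i => (ENNReal.toReal_ofReal (shotTerm_nonneg hh hω i)).symm

theorem isNonnegLaw_shotNoiseTransform (hh : IsResponse h) (hr : 0 < r) (hμ : IsNonnegLaw μ) :
    IsNonnegLaw (shotNoiseTransform h r μ) := by
  have hP := isProbabilityMeasure_shotNoiseBase hr hμ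
  have hm := aemeasurable_shotNoise hh hr hμ
  refine ⟨Measure.isProbabilityMeasure_map hm, ?_⟩
  rw [measure_eq_zero_iff_ae_notMem, shotNoiseTransform, ae_map_iff hm measurableSet_Iio.compl]
  filter_upwards [ae_shotNoise_eq (h := h) hr hμ, ae_shotNoiseBase hr hμ] with ω h1 hω
  rw [h1]
  simpa using tsum_nonneg (shotTerm_nonneg hh hω)

/-- The Laplace transform of the shot noise. -/
theorem lap_shotNoiseTransform (hh : IsResponse h) (hr : 0 < r) (hd : InShotNoiseDomain h μ)
    {s : ℝ} (hs : 0 < s) :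
    lap (shotNoiseTransform h r μ) s =
      Real.exp (-(r * ∫ u in Ioi (0 : ℝ), (1 - lap μ (s * h u)))) := by
  have hμ := hd.1
  have hT := isNonnegLaw_shotNoiseTransform hh hr hμ
  have hm := aemeasurable_shotNoise hh hr hμ
  have e : ∫ u in Ioi (0 : ℝ), (1 - lap μ (s * h u)) =
      ∫ u in Ioi (0 : ℝ), shotDefect h μ s u :=
    setIntegral_congr_fun measurableSet_Ioi fun u hu => by
      simp only [shotDefect]
      rw [extendZero_of_pos h hu]
  rw [← ENNReal.ofReal_eq_ofReal_iff (hT.lap_pos hs.le).le (Real.exp_pos _).le,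
    hT.ofReal_lap hs.le, e, ← lintegral_expNegSum hh hr hd hs]
  unfold shotNoiseTransform
  rw [lintegral_map' (by fun_prop) hm]
  refine lintegral_congr_ae ?_
  filter_upwards [ae_shotNoise_eq (h := h) hr hμ, ae_summable_shotTerm hh hr hd] with ω h1 h2
  rw [h1, expNegSum, if_pos h2]

end

/-! ### Finiteness of the mean -/

theorem exists_le_prod_of_summable {p : ℕ → ℝ} (hp0 : ∀ k, 0 < p k) (hp1 : ∀ k, p k ≤ 1)
    (hs : Summable fun k => 1 - p k) : ∃ δ > 0, ∀ n, δ ≤ ∏ k ∈ Finset.range n, p k := by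
  have h1 : Summable fun k => Real.log (p k) := by
    have := Real.summable_log_one_add_of_summable hs.neg
    refine this.congr fun k => ?_
    congr 1
    ring
  refine ⟨Real.exp (∑' k, Real.log (p k)), Real.exp_pos _, fun n => ?_⟩
  have h2 : ∏ k ∈ Finset.range n, p k = Real.exp (∑ k ∈ Finset.range n, Real.log (p k)) := by
    rw [Real.exp_sum]
    exact Finset.prod_congr rfl fun k _ => (Real.exp_log (hp0 k)).symm
  rw [h2, Real.exp_le_exp]
  have h3 := h1.neg.sum_le_tsum (Finset.range n)
    fun k _ => neg_nonneg.2 (Real.log_nonpos (hp0 k).le (hp1 k))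
  rw [tsum_neg, Finset.sum_neg_distrib] at h3
  linarith

/-- A bootstrap: since p_n → 1, the product decays more slowly than any given exponential. The
hypothesis then makes 1 - p_n summable, which keeps the product away from 0. -/
theorem exists_le_prod_of_le {p : ℕ → ℝ} (hp0 : ∀ k, 0 < p k) (hp1 : ∀ k, p k ≤ 1)
    (hp : Tendsto p atTop (𝓝 1)) {c D : ℝ} (hc : 0 < c)
    (h : ∀ n, (1 - p n) * ∏ k ∈ Finset.range n, p k ≤ D * Real.exp (-(c * n))) :
    ∃ δ > 0, ∀ n, δ ≤ ∏ k ∈ Finset.range n, p k := by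
  -- Half the rate: the product is at least δ θ ^ n, while exp(-cn) = θ ^ (2n), so a factor θ ^ n is
  -- left over for 1 - p_n.
  set θ : ℝ := Real.exp (-(c / 2)) with hθ
  have hθ0 : 0 < θ := Real.exp_pos _
  have hθ1 : θ < 1 := Real.exp_lt_one_iff.2 (by linarith)
  obtain ⟨N, hN⟩ := eventually_atTop.1 (hp.eventually_const_le hθ1)
  set δ := ∏ k ∈ Finset.range N, p k with hδ
  have hδ0 : 0 < δ := Finset.prod_pos fun k _ => hp0 k
  have hlow : ∀ n, δ * θ ^ n ≤ ∏ k ∈ Finset.range n, p k := by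
    intro n
    rcases le_total n N with hn | hn
    · have h1 : δ ≤ ∏ k ∈ Finset.range n, p k := by
        rw [hδ, ← Finset.prod_range_mul_prod_Ico _ hn]
        exact mul_le_of_le_one_right (Finset.prod_pos fun k _ => hp0 k).le
          (Finset.prod_le_one (fun k _ => (hp0 k).le) fun k _ => hp1 k)
      exact (mul_le_of_le_one_right hδ0.le (pow_le_one₀ hθ0.le hθ1.le)).trans h1
    · induction n, hn using Nat.le_induction with
      | base => exact mul_le_of_le_one_right hδ0.le (pow_le_one₀ hθ0.le hθ1.le)
      | succ n hn ih =>
        rw [pow_succ, ← mul_assoc, Finset.prod_range_succ]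
        exact mul_le_mul ih (hN n hn) hθ0.le (Finset.prod_pos fun k _ => hp0 k).le
  refine exists_le_prod_of_summable hp0 hp1 ?_
  refine Summable.of_nonneg_of_le (fun k => sub_nonneg.2 (hp1 k)) (fun n => ?_)
    ((summable_geometric_of_lt_one hθ0.le hθ1).mul_left (D / δ))
  have h1 : (1 - p n) * (δ * θ ^ n) ≤ D * Real.exp (-(c * n)) :=
    (mul_le_mul_of_nonneg_left (hlow n) (sub_nonneg.2 (hp1 n))).trans (h n)
  have h2 : Real.exp (-(c * n)) = θ ^ n * θ ^ n := by
    rw [hθ, ← Real.exp_nat_mul, ← Real.exp_add]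
    congr 1
    ring
  rw [h2] at h1
  have h3 : 0 < θ ^ n := by positivity
  rw [div_mul_eq_mul_div, le_div_iff₀ hδ0]
  refine le_of_mul_le_mul_right ?_ h3
  linarith

namespace IsNonnegLaw

variable {μ : Measure ℝ}

theorem defect_div_anti (hμ : IsNonnegLaw μ) {s t : ℝ} (hs : 0 < s) (hst : s ≤ t) :
    (1 - lap μ t) / t ≤ (1 - lap μ s) / s := by
  have := hμ.isProb
  have ht : 0 < t := hs.trans_le hst
  have hle : lap μ s ≤ s / t * lap μ t + (1 - s / t) := by
    have h1 : s / t * lap μ t + (1 - s / t) =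
        ∫ x, (s / t * Real.exp (-(t * x)) + (1 - s / t)) ∂μ := by
      rw [integral_add ((hμ.integrable_exp ht.le).const_mul _) (integrable_const _),
        integral_const_mul]
      simp [lap]
    rw [h1]
    refine integral_mono (hμ.integrable_exp hs.le)
      (((hμ.integrable_exp ht.le).const_mul _).add (integrable_const _)) fun x => ?_
    -- Convexity at -sx, which is the combination of -tx and 0 with weight s/t on the former.
    have h2 := convexOn_exp.2 (mem_univ (-(t * x))) (mem_univ 0) (by positivity : 0 ≤ s / t)
      (sub_nonneg.2 ((div_le_one ht).2 hst)) (by ring)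
    simp only [smul_eq_mul, mul_zero, add_zero, Real.exp_zero, mul_one] at h2
    refine le_trans (le_of_eq ?_) h2
    congr 1
    field_simp
  rw [div_le_div_iff₀ ht hs]
  have h3 := mul_le_mul_of_nonneg_right hle ht.le
  have h4 : (s / t * lap μ t + (1 - s / t)) * t = s * lap μ t + t - s := by
    field_simp
    ring
  rw [h4] at h3
  linarith

/-- Fatou's lemma, since (1 - exp(-ux))/u tends to x as u → 0. -/
theorem lawMean_le (hμ : IsNonnegLaw μ) {u : ℕ → ℝ} {B : ℝ} (hu0 : ∀ n, 0 < u n)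
    (hu : Tendsto u atTop (𝓝 0)) (hB : ∀ n, (1 - lap μ (u n)) / u n ≤ B) :
    lawMean μ ≤ ENNReal.ofReal B := by
  have h1 : ∀ n, ∫⁻ x, ENNReal.ofReal ((u n)⁻¹ * (1 - Real.exp (-(u n * x)))) ∂μ ≤
      ENNReal.ofReal B := by
    intro n
    have h0 : 0 ≤ (u n)⁻¹ := inv_nonneg.2 (hu0 n).le
    simp only [ENNReal.ofReal_mul h0]
    rw [lintegral_const_mul _ (by fun_prop), ← hμ.one_sub_lap_eq (hu0 n).le,
      ← ENNReal.ofReal_mul h0]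
    refine ENNReal.ofReal_le_ofReal (le_trans (le_of_eq ?_) (hB n))
    rw [div_eq_inv_mul]
  have h2 : ∀ x : ℝ, Tendsto (fun n => (u n)⁻¹ * (1 - Real.exp (-(u n * x)))) atTop (𝓝 x) := by
    intro x
    have hder : HasDerivAt (fun v : ℝ => 1 - Real.exp (-(v * x))) x 0 := by
      have h := (((hasDerivAt_id (0 : ℝ)).mul_const x).neg.exp).const_sub 1
      refine HasDerivAt.congr_deriv (f := fun v : ℝ => 1 - Real.exp (-(v * x))) h ?_
      simp
    have hu' : Tendsto u atTop (𝓝[≠] 0) :=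
      tendsto_nhdsWithin_iff.2 ⟨hu, .of_forall fun n => (hu0 n).ne'⟩
    have := hder.tendsto_slope_zero.comp hu'
    simpa [Function.comp_def] using this
  calc lawMean μ = ∫⁻ x, liminf
        (fun n => ENNReal.ofReal ((u n)⁻¹ * (1 - Real.exp (-(u n * x))))) atTop ∂μ :=
        lintegral_congr fun x => ((ENNReal.tendsto_ofReal (h2 x)).liminf_eq).symm
    _ ≤ liminf (fun n => ∫⁻ x, ENNReal.ofReal ((u n)⁻¹ * (1 - Real.exp (-(u n * x)))) ∂μ) atTop :=
        lintegral_liminf_le fun n => by fun_prop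
    _ ≤ ENNReal.ofReal B := liminf_le_of_le (by isBoundedDefault) fun b hb =>
        (hb.exists.choose_spec).trans (h1 _)

end IsNonnegLaw

/-- A truncation of a variable with negative integral has negative mean. -/
theorem exists_truncation {α : Type*} [MeasurableSpace α] {ρ : Measure α} [IsFiniteMeasure ρ]
    {f : α → ℝ} (hf : Measurable f) (h : HasNegIntegral f ρ) :
    ∃ M : ℝ, Integrable (fun a => min (-f a) M) ρ ∧ 0 < ∫ a, min (-f a) M ∂ρ := by
  have hsup : ∫⁻ a, ENNReal.ofReal (-f a) ∂ρ =
      ⨆ n : ℕ, ∫⁻ a, ENNReal.ofReal (min (-f a) n) ∂ρ := by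
    rw [← lintegral_iSup (fun n => by fun_prop)]
    · refine lintegral_congr fun a => le_antisymm ?_ (iSup_le fun n =>
        ENNReal.ofReal_le_ofReal (min_le_left _ _))
      obtain ⟨n, hn⟩ := exists_nat_ge (-f a)
      exact le_iSup_of_le n (by rw [min_eq_left hn])
    · intro m n hmn a
      exact ENNReal.ofReal_le_ofReal (min_le_min_left _ (by exact_mod_cast hmn))
  unfold HasNegIntegral at h
  rw [hsup] at h
  obtain ⟨n, hn⟩ := lt_iSup_iff.1 h
  have hneg : ∀ a, ENNReal.ofReal (-min (-f a) n) = ENNReal.ofReal (f a) := by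
    -- The level n is non-negative, so truncating -f from above leaves the positive part of f
    -- untouched.
    intro a
    rcases le_total (-f a) n with h1 | h1
    · rw [min_eq_left h1, neg_neg]
    · have h2 : (0 : ℝ) ≤ n := Nat.cast_nonneg n
      rw [min_eq_right h1, ENNReal.ofReal_of_nonpos (by linarith),
        ENNReal.ofReal_of_nonpos (by linarith)]
  have hfin : ∫⁻ a, ENNReal.ofReal (min (-f a) n) ∂ρ < ⊤ := by
    refine (lintegral_mono fun a => ENNReal.ofReal_le_ofReal (min_le_right (-f a) n)).trans_lt ?_
    rw [lintegral_const]
    exact ENNReal.mul_lt_top ENNReal.ofReal_lt_top (measure_lt_top _ _)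
  have hint : Integrable (fun a => min (-f a) (n : ℝ)) ρ := by
    refine ⟨(by fun_prop : Measurable fun a => min (-f a) (n : ℝ)).aestronglyMeasurable, ?_⟩
    rw [hasFiniteIntegral_iff_norm]
    have e : ∀ a, ENNReal.ofReal ‖min (-f a) (n : ℝ)‖ ≤
        ENNReal.ofReal (min (-f a) n) + ENNReal.ofReal (f a) := by
      intro a
      rw [← hneg a, Real.norm_eq_abs]
      rcases abs_cases (min (-f a) (n : ℝ)) with h1 | h1
      · rw [h1.1]; exact le_self_add
      · rw [h1.1]; exact le_add_self
    refine (lintegral_mono e).trans_lt ?_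
    rw [lintegral_add_left (by fun_prop)]
    exact ENNReal.add_lt_top.2 ⟨hfin, hn.trans hfin⟩
  refine ⟨n, hint, ?_⟩
  rw [integral_eq_lintegral_pos_part_sub_lintegral_neg_part hint, sub_pos]
  simp only [hneg]
  exact (ENNReal.toReal_lt_toReal (hn.trans hfin).ne hfin.ne).2 hn

section

variable {ρ : Measure ℝ}

theorem iterState_mul (ω : ℕ → ℝ) (n : ℕ) :
    iterState (fun x a : ℝ => x * a) 1 ω n = ∏ i ∈ Finset.range n, ω i := by
  induction n with
  | zero => rfl
  | succ n ih => rw [iterState, ih, Finset.prod_range_succ]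

/-- Products of i.i.d. positive variables with negative mean logarithm decay exponentially. -/
theorem ae_prod_le_exp [IsProbabilityMeasure ρ] (hpos : ∀ᵐ a ∂ρ, 0 < a)
    (h : HasNegIntegral Real.log ρ) :
    ∃ c > 0, ∀ᵐ ω ∂(Measure.infinitePi fun _ : ℕ => ρ), (∀ i, 0 < ω i) ∧
      ∃ C : ℕ, ∀ n : ℕ, ∏ i ∈ Finset.range n, ω i ≤ (C + 1) * Real.exp (-(c * n)) := by
  -- E log A may be -∞; the truncated variable is integrable, so the strong law applies, and it
  -- still has positive mean.
  obtain ⟨M, hint, hM⟩ := exists_truncation Real.measurable_log h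
  set P := Measure.infinitePi fun _ : ℕ => ρ with hP
  set X : ℝ → ℝ := fun a => min (-Real.log a) M with hX
  have hXm : Measurable X := by simp only [hX]; fun_prop
  have hmp : ∀ i, MeasurePreserving (fun ω : ℕ → ℝ => ω i) P ρ := fun i =>
    measurePreserving_eval_infinitePi (fun _ : ℕ => ρ) i
  have hslln := strong_law_ae_real (μ := P) (fun i ω => X (ω i))
    ((hmp 0).integrable_comp_of_integrable hint)
    (fun i j hij => (iIndepFun_infinitePi (P := fun _ : ℕ => ρ) (X := fun _ => X)
      fun _ => hXm).indepFun hij)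
    (fun i => ⟨(hXm.comp (hmp i).measurable).aemeasurable, (hXm.comp (hmp 0).measurable).aemeasurable,
      by
        change Measure.map (X ∘ fun ω : ℕ → ℝ => ω i) P = Measure.map (X ∘ fun ω : ℕ → ℝ => ω 0) P
        rw [← Measure.map_map hXm (hmp i).measurable, ← Measure.map_map hXm (hmp 0).measurable,
          (hmp i).map_eq, (hmp 0).map_eq]⟩)
  have hmean : P[fun ω => X (ω 0)] = ∫ a, X a ∂ρ := by
    rw [← (hmp 0).map_eq, integral_map (hmp 0).measurable.aemeasurable hXm.aestronglyMeasurable]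
  rw [hmean] at hslln
  set m := ∫ a, X a ∂ρ with hm
  have hallpos : ∀ᵐ ω ∂P, ∀ i, 0 < ω i := ae_all_iff.2 fun i =>
    (hmp i).quasiMeasurePreserving.ae hpos
  refine ⟨m / 2, half_pos hM, ?_⟩
  filter_upwards [hslln, hallpos] with ω h1 h2
  refine ⟨h2, ?_⟩
  -- Eventually the averages exceed half their limit; the finitely many earlier terms are absorbed
  -- in the constant `C`.
  have hev : ∀ᶠ n : ℕ in atTop,
      (∏ i ∈ Finset.range n, ω i) * Real.exp (m / 2 * n) ≤ 1 := by
    filter_upwards [h1.eventually_const_lt (half_lt_self hM), eventually_gt_atTop 0] with n hn hn0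
    have hn' : (0 : ℝ) < n := by exact_mod_cast hn0
    rw [lt_div_iff₀ hn'] at hn
    have e : ∏ i ∈ Finset.range n, ω i = Real.exp (∑ i ∈ Finset.range n, Real.log (ω i)) := by
      rw [Real.exp_sum]
      exact Finset.prod_congr rfl fun i _ => (Real.exp_log (h2 i)).symm
    rw [e, ← Real.exp_add, Real.exp_le_one_iff]
    have h3 : ∑ i ∈ Finset.range n, X (ω i) ≤ ∑ i ∈ Finset.range n, -Real.log (ω i) :=
      Finset.sum_le_sum fun i _ => min_le_left _ _
    rw [Finset.sum_neg_distrib] at h3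
    linarith
  obtain ⟨K, hK⟩ := (isBoundedUnder_of_eventually_le hev).bddAbove_range
  obtain ⟨C, hC⟩ := exists_nat_ge K
  refine ⟨C, fun n => ?_⟩
  have h3 : (∏ i ∈ Finset.range n, ω i) * Real.exp (m / 2 * n) ≤ C + 1 :=
    ((hK ⟨n, rfl⟩).trans hC).trans (by linarith)
  rwa [Real.exp_neg, ← div_eq_mul_inv, le_div_iff₀ (Real.exp_pos _)]

variable {μ : Measure ℝ}

/-- `hψ` makes s ↦ (1 - φ(s))/s superharmonic for the multiplicative walk with weights φ. On an
event of positive probability the walk lies below a deterministic geometric sequence, and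
monotonicity replaces the walk by that sequence. -/
theorem exists_defect_mul_prod_le [IsProbabilityMeasure ρ] (hμ : IsNonnegLaw μ)
    (hpos : ∀ᵐ a ∂ρ, 0 < a) (h : HasNegIntegral Real.log ρ)
    (hψ : ∀ s, 0 < s → ENNReal.ofReal (lap μ s) *
      ∫⁻ a, ENNReal.ofReal ((1 - lap μ (s * a)) / (s * a)) ∂ρ ≤
        ENNReal.ofReal ((1 - lap μ s) / s)) :
    ∃ c > 0, ∃ C > 0, ∃ D, ∀ n : ℕ,
      (∏ k ∈ Finset.range n, lap μ (C * Real.exp (-(c * k)))) *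
        ((1 - lap μ (C * Real.exp (-(c * n)))) / (C * Real.exp (-(c * n)))) ≤ D := by
  obtain ⟨c, hc, hae⟩ := ae_prod_le_exp hpos h
  set P := Measure.infinitePi fun _ : ℕ => ρ with hP
  let E : ℕ → Set (ℕ → ℝ) := fun C =>
    {ω | (∀ i, 0 < ω i) ∧ ∀ n : ℕ, ∏ i ∈ Finset.range n, ω i ≤ (C + 1) * Real.exp (-(c * n))}
  have hEm : ∀ C, MeasurableSet (E C) := by
    intro C
    have e : E C = (⋂ i, {ω | 0 < ω i}) ∩
        ⋂ n : ℕ, {ω | ∏ i ∈ Finset.range n, ω i ≤ (C + 1) * Real.exp (-(c * n))} := by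
      ext ω; simp [E]
    rw [e]
    refine (MeasurableSet.iInter fun i => ?_).inter (MeasurableSet.iInter fun n => ?_)
    · exact measurableSet_lt measurable_const (measurable_pi_apply i)
    · exact measurableSet_le (by fun_prop) measurable_const
  -- Countably many events `E C` cover almost every path, so one of them has positive probability;
  -- dividing by it gives the bound.
  obtain ⟨C, hC⟩ : ∃ C, P (E C) ≠ 0 := by
    by_contra hcon
    push Not at hcon
    have h0 : P (⋃ C, E C) = 0 := measure_iUnion_null hcon
    have h1 : ∀ᵐ ω ∂P, False := by
      filter_upwards [hae, measure_eq_zero_iff_ae_notMem.1 h0] with ω h2 h3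
      obtain ⟨h4, C, h5⟩ := h2
      exact h3 (mem_iUnion.2 ⟨C, h4, h5⟩)
    exact IsProbabilityMeasure.ne_zero P (by simpa using h1)
  have hC0 : (0 : ℝ) < C + 1 := by positivity
  refine ⟨c, hc, (C : ℝ) + 1, hC0, ((1 - lap μ 1) / 1) / (P (E C)).toReal, fun n => ?_⟩
  set u : ℕ → ℝ := fun k => (C + 1) * Real.exp (-(c * k)) with hu
  have hu0 : ∀ k, 0 < u k := fun k => by positivity
  change (∏ k ∈ Finset.range n, lap μ (u k)) * ((1 - lap μ (u n)) / u n) ≤ _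
  have hPE : 0 < (P (E C)).toReal := ENNReal.toReal_pos hC (measure_ne_top _ _)
  have hchain : ∫⁻ ω, (∏ i ∈ Finset.range n,
      ENNReal.ofReal (lap μ (∏ j ∈ Finset.range i, ω j))) *
      ENNReal.ofReal ((1 - lap μ (∏ j ∈ Finset.range n, ω j)) / ∏ j ∈ Finset.range n, ω j) ∂P ≤
      ENNReal.ofReal ((1 - lap μ 1) / 1) := by
    have hml := hμ.measurable_lap
    have h1 := iterate_weightedStep_le (κ := ρ) (f := fun x a : ℝ => x * a)
      (w := fun x _ => ENNReal.ofReal (lap μ x))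
      (V := fun x => ENNReal.ofReal ((1 - lap μ x) / x)) (I := Ioi 0)
      (fun x hx => hpos.mono fun a ha => mul_pos hx ha)
      (fun x hx => by
        rw [weightedStep, lintegral_const_mul' _ _ ENNReal.ofReal_ne_top]
        exact hψ x hx) n 1 (mem_Ioi.2 one_pos)
    rw [← lintegral_iterWeight ρ (by unfold Function.uncurry; fun_prop)
      (by unfold Function.uncurry; fun_prop) (by fun_prop) n 1] at h1
    simpa only [iterState_mul] using h1
  have hlow : ENNReal.ofReal ((∏ k ∈ Finset.range n, lap μ (u k)) * ((1 - lap μ (u n)) / u n)) *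
      P (E C) ≤ ENNReal.ofReal ((1 - lap μ 1) / 1) := by
    refine le_trans ?_ hchain
    rw [← lintegral_indicator_const (hEm C)]
    refine lintegral_mono fun ω => ?_
    by_cases hω : ω ∈ E C
    · rw [indicator_of_mem hω]
      have hT : ∀ k, 0 < ∏ j ∈ Finset.range k, ω j := fun k => Finset.prod_pos fun j _ => hω.1 j
      rw [ENNReal.ofReal_mul (Finset.prod_nonneg fun k _ => (hμ.lap_pos (hu0 k).le).le),
        ENNReal.ofReal_prod_of_nonneg fun k _ => (hμ.lap_pos (hu0 k).le).le]
      refine mul_le_mul' (Finset.prod_le_prod' fun k _ => ?_) ?_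
      · exact ENNReal.ofReal_le_ofReal (hμ.lap_anti (hT k).le (hω.2 k))
      · exact ENNReal.ofReal_le_ofReal (hμ.defect_div_anti (hT n) (hω.2 n))
    · rw [indicator_of_notMem hω]
      exact zero_le
  rw [le_div_iff₀ hPE]
  have h1 : 0 ≤ (1 - lap μ 1) / 1 := by
    rw [div_one]
    exact sub_nonneg.2 (hμ.lap_le_one zero_le_one)
  rw [← ENNReal.ofReal_toReal (measure_ne_top P (E C)), ← ENNReal.ofReal_mul'
    ENNReal.toReal_nonneg, ENNReal.ofReal_le_ofReal_iff h1] at hlow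
  exact hlow

theorem lawMean_lt_top_of_defect_le [IsProbabilityMeasure ρ] (hμ : IsNonnegLaw μ)
    (hpos : ∀ᵐ a ∂ρ, 0 < a) (h : HasNegIntegral Real.log ρ)
    (hψ : ∀ s, 0 < s → ENNReal.ofReal (lap μ s) *
      ∫⁻ a, ENNReal.ofReal ((1 - lap μ (s * a)) / (s * a)) ∂ρ ≤
        ENNReal.ofReal ((1 - lap μ s) / s)) : lawMean μ < ⊤ := by
  obtain ⟨c, hc, C, hC, D, hD⟩ := exists_defect_mul_prod_le hμ hpos h hψ
  set u : ℕ → ℝ := fun k => C * Real.exp (-(c * k)) with hu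
  have hu0 : ∀ k, 0 < u k := fun k => by positivity
  have hulim : Tendsto u atTop (𝓝 0) := by
    have h1 : Tendsto (fun n : ℕ => c * (n : ℝ)) atTop atTop :=
      tendsto_natCast_atTop_atTop.const_mul_atTop hc
    have h2 := (Real.tendsto_exp_neg_atTop_nhds_zero.comp h1).const_mul C
    rw [mul_zero] at h2
    exact h2
  have hp1 : ∀ k, lap μ (u k) ≤ 1 := fun k => hμ.lap_le_one (hu0 k).le
  have hp0 : ∀ k, 0 < lap μ (u k) := fun k => hμ.lap_pos (hu0 k).le
  have hplim : Tendsto (fun k => lap μ (u k)) atTop (𝓝 1) := by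
    rw [← hμ.lap_zero]
    exact (hμ.continuousOn_lap 0 (mem_Ici.2 le_rfl)).tendsto.comp
      (tendsto_nhdsWithin_iff.2 ⟨hulim, .of_forall fun k => (hu0 k).le⟩)
  obtain ⟨δ, hδ, hprod⟩ := exists_le_prod_of_le (D := D * C) hp0 hp1 hplim hc fun n => by
    have h1 : (∏ k ∈ Finset.range n, lap μ (u k)) * ((1 - lap μ (u n)) / u n) ≤ D := hD n
    rw [← mul_div_assoc, div_le_iff₀ (hu0 n)] at h1
    calc (1 - lap μ (u n)) * ∏ k ∈ Finset.range n, lap μ (u k) ≤ D * u n := by linarith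
      _ = D * C * Real.exp (-(c * n)) := by rw [hu]; ring
  refine (hμ.lawMean_le (B := D / δ) hu0 hulim fun n => ?_).trans_lt ENNReal.ofReal_lt_top
  rw [le_div_iff₀ hδ, mul_comm]
  refine le_trans ?_ (hD n)
  exact mul_le_mul_of_nonneg_right (hprod n) (div_nonneg (sub_nonneg.2 (hp1 n)) (hu0 n).le)

end

/-! ### The perpetuity equation as an equation for Laplace transforms -/

/-- The negative of the derivative of the Laplace transform. -/
noncomputable def lapJ (μ : Measure ℝ) (s : ℝ) : ℝ := ∫ x, x * Real.exp (-(s * x)) ∂μ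

/-- The Laplace exponent with Lévy measure `z⁻¹ ρ(dz)`. -/
noncomputable def lapExponent (μ ρ : Measure ℝ) (s : ℝ) : ℝ := ∫ z, (1 - lap μ (s * z)) / z ∂ρ

namespace IsNonnegLaw

variable {μ : Measure ℝ}

theorem integrable_id (hμ : IsNonnegLaw μ) (hm : lawMean μ < ⊤) : Integrable (fun x => x) μ := by
  refine ⟨measurable_id.aestronglyMeasurable, ?_⟩
  rwa [hasFiniteIntegral_iff_ofReal hμ.ae_nonneg]

theorem integral_id_eq (hμ : IsNonnegLaw μ) : ∫ x, x ∂μ = (lawMean μ).toReal :=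
  integral_eq_lintegral_of_nonneg_ae hμ.ae_nonneg measurable_id.aestronglyMeasurable

theorem ae_norm_mul_exp_le (hμ : IsNonnegLaw μ) :
    ∀ᵐ x ∂μ, ∀ s : ℝ, 0 ≤ s → ‖x * Real.exp (-(s * x))‖ ≤ x := by
  filter_upwards [hμ.ae_nonneg] with x hx s hs
  rw [Real.norm_of_nonneg (by positivity)]
  refine mul_le_of_le_one_right hx (Real.exp_le_one_iff.2 (neg_nonpos.2 (by positivity)))

theorem integrable_mul_exp (hμ : IsNonnegLaw μ) (hm : lawMean μ < ⊤) {s : ℝ} (hs : 0 ≤ s) :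
    Integrable (fun x => x * Real.exp (-(s * x))) μ :=
  (hμ.integrable_id hm).mono' (by fun_prop) (hμ.ae_norm_mul_exp_le.mono fun _ h => h s hs)

theorem lapJ_nonneg (hμ : IsNonnegLaw μ) (s : ℝ) : 0 ≤ lapJ μ s := by
  refine integral_nonneg_of_ae ?_
  filter_upwards [hμ.ae_nonneg] with x hx
  simp only [Pi.zero_apply]
  positivity

theorem lapJ_le (hμ : IsNonnegLaw μ) (hm : lawMean μ < ⊤) {s : ℝ} (hs : 0 ≤ s) :
    lapJ μ s ≤ (lawMean μ).toReal := by
  rw [← hμ.integral_id_eq]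
  refine integral_mono_ae (hμ.integrable_mul_exp hm hs) (hμ.integrable_id hm) ?_
  filter_upwards [hμ.ae_norm_mul_exp_le] with x hx
  exact (le_abs_self _).trans (hx s hs)

theorem measurable_lapJ (hμ : IsNonnegLaw μ) : Measurable (lapJ μ) := by
  have := hμ.isProb
  have : StronglyMeasurable (Function.uncurry fun s x : ℝ => x * Real.exp (-(s * x))) := by
    apply Measurable.stronglyMeasurable
    unfold Function.uncurry
    fun_prop
  exact this.integral_prod_right.measurable

theorem hasDerivAt_lap (hμ : IsNonnegLaw μ) (hm : lawMean μ < ⊤) {s : ℝ} (hs : 0 < s) :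
    HasDerivAt (lap μ) (-lapJ μ s) s := by
  have := hμ.isProb
  have h := (hasDerivAt_integral_of_dominated_loc_of_deriv_le (μ := μ) (𝕜 := ℝ)
    (F := fun s x => Real.exp (-(s * x))) (F' := fun s x => -(x * Real.exp (-(s * x))))
    (x₀ := s) (s := Ioi 0) (bound := fun x => x) (Ioi_mem_nhds hs)
    (.of_forall fun s => by fun_prop) (hμ.integrable_exp hs.le) (by fun_prop)
    (by
      filter_upwards [hμ.ae_norm_mul_exp_le] with x hx t ht
      rw [norm_neg]
      exact hx t (le_of_lt ht))
    (hμ.integrable_id hm)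
    (.of_forall fun x t _ => by
      refine (((hasDerivAt_id t).mul_const x).neg.exp).congr_deriv ?_
      simp [mul_comm])).2
  rw [integral_neg] at h
  exact h

theorem one_sub_lap_le (hμ : IsNonnegLaw μ) (hm : lawMean μ < ⊤) {s : ℝ} (hs : 0 ≤ s) :
    1 - lap μ s ≤ s * (lawMean μ).toReal := by
  have := hμ.isProb
  rw [← hμ.integral_id_eq, ← integral_const_mul]
  have e : 1 - lap μ s = ∫ x, (1 - Real.exp (-(s * x))) ∂μ := by
    rw [integral_sub (integrable_const 1) (hμ.integrable_exp hs)]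
    simp [lap]
  rw [e]
  refine integral_mono ((integrable_const 1).sub (hμ.integrable_exp hs))
    ((hμ.integrable_id hm).const_mul s) fun x => ?_
  simp only
  linarith [Real.add_one_le_exp (-(s * x))]

variable {ρ : Measure ℝ}

theorem norm_defect_div_le (hμ : IsNonnegLaw μ) (hm : lawMean μ < ⊤) {s z : ℝ} (hs : 0 ≤ s)
    (hz : 0 < z) : ‖(1 - lap μ (s * z)) / z‖ ≤ s * (lawMean μ).toReal := by
  have h1 := sub_nonneg.2 (hμ.lap_le_one (mul_nonneg hs hz.le))
  rw [Real.norm_of_nonneg (div_nonneg h1 hz.le), div_le_iff₀ hz]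
  linarith [hμ.one_sub_lap_le hm (mul_nonneg hs hz.le)]

/-- The factor z from the chain rule cancels the Lévy density z⁻¹, and the finite mean dominates the
resulting integrand. -/
theorem hasDerivAt_lapExponent [IsProbabilityMeasure ρ] (hμ : IsNonnegLaw μ)
    (hm : lawMean μ < ⊤) (hpos : ∀ᵐ a ∂ρ, 0 < a) {s : ℝ} (hs : 0 < s) :
    HasDerivAt (lapExponent μ ρ) (∫ z, lapJ μ (s * z) ∂ρ) s := by
  have hml := hμ.measurable_lap
  have hmJ := hμ.measurable_lapJ
  have hmeas : ∀ s, AEStronglyMeasurable (fun z => (1 - lap μ (s * z)) / z) ρ := fun s =>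
    (by fun_prop : Measurable fun z => (1 - lap μ (s * z)) / z).aestronglyMeasurable
  refine (hasDerivAt_integral_of_dominated_loc_of_deriv_le (μ := ρ) (𝕜 := ℝ)
    (F := fun s z => (1 - lap μ (s * z)) / z) (F' := fun s z => lapJ μ (s * z))
    (x₀ := s) (s := Ioi 0) (bound := fun _ => (lawMean μ).toReal) (Ioi_mem_nhds hs)
    (.of_forall hmeas) ?_ ?_ ?_ (integrable_const _) ?_).2
  · exact Integrable.of_bound (hmeas s) (s * (lawMean μ).toReal)
      (hpos.mono fun z hz => hμ.norm_defect_div_le hm hs.le hz)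
  · exact (by fun_prop : Measurable fun z => lapJ μ (s * z)).aestronglyMeasurable
  · filter_upwards [hpos] with z hz t ht
    rw [Real.norm_of_nonneg (hμ.lapJ_nonneg _)]
    exact hμ.lapJ_le hm (mul_nonneg (le_of_lt ht) hz.le)
  · filter_upwards [hpos] with z hz t ht
    have h1 : HasDerivAt (fun t => lap μ (t * z)) (-lapJ μ (t * z) * (1 * z)) t :=
      HasDerivAt.comp (h₂ := lap μ) t (hμ.hasDerivAt_lap hm (mul_pos ht hz))
        ((hasDerivAt_id t).mul_const z)
    refine ((h1.const_sub 1).div_const z).congr_deriv ?_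
    field_simp

theorem tendsto_lapExponent [IsProbabilityMeasure ρ] (hμ : IsNonnegLaw μ)
    (hm : lawMean μ < ⊤) (hpos : ∀ᵐ a ∂ρ, 0 < a) :
    Tendsto (lapExponent μ ρ) (𝓝[>] 0) (𝓝 0) := by
  have h1 : Tendsto (fun s : ℝ => s * (lawMean μ).toReal) (𝓝[>] 0) (𝓝 0) := by
    have : Tendsto (fun s : ℝ => s * (lawMean μ).toReal) (𝓝 0) (𝓝 (0 * (lawMean μ).toReal)) :=
      tendsto_id.mul_const _
    rw [zero_mul] at this
    exact this.mono_left nhdsWithin_le_nhds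
  refine squeeze_zero_norm' ?_ h1
  filter_upwards [self_mem_nhdsWithin] with s hs
  have := norm_integral_le_of_norm_le_const (μ := ρ)
    (hpos.mono fun z hz => hμ.norm_defect_div_le hm (le_of_lt hs) hz)
  simpa [lapExponent] using this

/-- The functional equation of the size-biased law in integrated form. -/
theorem lap_eq_exp_of_lapJ_eq [IsProbabilityMeasure ρ] (hμ : IsNonnegLaw μ)
    (hm : lawMean μ < ⊤) (hpos : ∀ᵐ a ∂ρ, 0 < a)
    (h : ∀ s, 0 < s → lapJ μ s = (∫ z, lapJ μ (s * z) ∂ρ) * lap μ s) {s : ℝ} (hs : 0 < s) :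
    lap μ s = Real.exp (-lapExponent μ ρ s) := by
  -- Integrating factor: φ exp(Φ), with Φ the Laplace exponent, has zero derivative and tends to 1
  -- at 0+.
  have hder : ∀ t ∈ Ioi (0 : ℝ),
      HasDerivAt (fun t => lap μ t * Real.exp (lapExponent μ ρ t)) 0 t := fun t ht => by
    refine ((hμ.hasDerivAt_lap hm ht).mul
      (hμ.hasDerivAt_lapExponent hm hpos ht).exp).congr_deriv ?_
    rw [h t ht]
    ring
  have hconst : ∀ t ∈ Ioi (0 : ℝ), lap μ t * Real.exp (lapExponent μ ρ t) =
      lap μ s * Real.exp (lapExponent μ ρ s) := fun t ht =>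
    isOpen_Ioi.is_const_of_deriv_eq_zero isPreconnected_Ioi
      (fun x hx => (hder x hx).differentiableAt.differentiableWithinAt)
      (fun x hx => (hder x hx).deriv) ht hs
  have hlim : Tendsto (fun t => lap μ t * Real.exp (lapExponent μ ρ t)) (𝓝[>] 0) (𝓝 1) := by
    have h1 : Tendsto (lap μ) (𝓝[>] 0) (𝓝 1) := by
      rw [← hμ.lap_zero]
      exact ((hμ.continuousOn_lap 0 (mem_Ici.2 le_rfl)).mono Ioi_subset_Ici_self).tendsto
    have h2 := h1.mul (hμ.tendsto_lapExponent hm hpos).rexp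
    simpa using h2
  have h1 : lap μ s * Real.exp (lapExponent μ ρ s) = 1 :=
    tendsto_nhds_unique (tendsto_const_nhds.congr' (by
      filter_upwards [self_mem_nhdsWithin] with t ht using (hconst t ht).symm)) hlim
  rw [Real.exp_neg]
  exact eq_inv_of_mul_eq_one_left h1

theorem lapJ_eq_of_lap_eq_exp [IsProbabilityMeasure ρ] (hμ : IsNonnegLaw μ)
    (hm : lawMean μ < ⊤) (hpos : ∀ᵐ a ∂ρ, 0 < a)
    (h : ∀ s, 0 < s → lap μ s = Real.exp (-lapExponent μ ρ s)) {s : ℝ} (hs : 0 < s) :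
    lapJ μ s = (∫ z, lapJ μ (s * z) ∂ρ) * lap μ s := by
  have h1 := hμ.hasDerivAt_lap hm hs
  have h2 : HasDerivAt (lap μ)
      (Real.exp (-lapExponent μ ρ s) * -(∫ z, lapJ μ (s * z) ∂ρ)) s :=
    ((hμ.hasDerivAt_lapExponent hm hpos hs).neg.exp).congr_of_eventuallyEq
      (by filter_upwards [Ioi_mem_nhds hs] with t ht using h t ht)
  have h3 := h1.unique h2
  rw [← h s hs] at h3
  linarith

theorem sizeBiased_isNonnegLaw (hμ : IsNonnegLaw μ) (h0 : 0 < lawMean μ) (hm : lawMean μ < ⊤) :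
    IsNonnegLaw (sizeBiased μ) := by
  refine ⟨⟨?_⟩, ?_⟩
  · rw [sizeBiased, Measure.smul_apply, withDensity_apply _ MeasurableSet.univ, setLIntegral_univ,
      smul_eq_mul]
    exact ENNReal.inv_mul_cancel h0.ne' hm.ne
  · rw [sizeBiased, Measure.smul_apply, withDensity_absolutelyContinuous _ _ hμ.neg_null, smul_zero]

theorem lap_sizeBiased (hμ : IsNonnegLaw μ) (s : ℝ) :
    lap (sizeBiased μ) s = (lawMean μ).toReal⁻¹ * lapJ μ s := by
  rw [lap, sizeBiased, integral_smul_measure, ENNReal.toReal_inv, smul_eq_mul,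
    integral_withDensity_eq_integral_toReal_smul (by fun_prop)
      (.of_forall fun _ => ENNReal.ofReal_lt_top), lapJ]
  congr 1
  refine integral_congr_ae ?_
  filter_upwards [hμ.ae_nonneg] with x hx
  rw [ENNReal.toReal_ofReal hx, smul_eq_mul]

end IsNonnegLaw

section

variable {μ ρ σ : Measure ℝ}

theorem isNonnegLaw_affine [IsProbabilityMeasure ρ] (hpos : ∀ᵐ a ∂ρ, 0 < a) (hσ : IsNonnegLaw σ)
    (hμ : IsNonnegLaw μ) : IsNonnegLaw
      (Measure.map (fun p : (ℝ × ℝ) × ℝ => p.1.1 * p.1.2 + p.2) ((ρ.prod σ).prod μ)) := by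
  have := hσ.isProb
  have := hμ.isProb
  have hmeas : Measurable fun p : (ℝ × ℝ) × ℝ => p.1.1 * p.1.2 + p.2 := by fun_prop
  refine ⟨Measure.isProbabilityMeasure_map hmeas.aemeasurable, ?_⟩
  rw [measure_eq_zero_iff_ae_notMem, ae_map_iff hmeas.aemeasurable measurableSet_Iio.compl]
  have h1 : ∀ᵐ p ∂((ρ.prod σ).prod μ), 0 < p.1.1 := Measure.quasiMeasurePreserving_fst.ae
    (Measure.quasiMeasurePreserving_fst.ae (p := fun a => 0 < a) hpos)
  have h2 : ∀ᵐ p ∂((ρ.prod σ).prod μ), 0 ≤ p.1.2 := Measure.quasiMeasurePreserving_fst.ae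
    (Measure.quasiMeasurePreserving_snd.ae (p := fun a => 0 ≤ a) hσ.ae_nonneg)
  have h3 : ∀ᵐ p ∂((ρ.prod σ).prod μ), 0 ≤ p.2 := Measure.quasiMeasurePreserving_snd.ae
    hμ.ae_nonneg
  filter_upwards [h1, h2, h3] with p h1 h2 h3
  rw [mem_Iio, not_lt]
  positivity

theorem lap_affine [IsProbabilityMeasure ρ] (hpos : ∀ᵐ a ∂ρ, 0 < a) (hσ : IsNonnegLaw σ)
    (hμ : IsNonnegLaw μ) {s : ℝ} (hs : 0 ≤ s) :
    lap (Measure.map (fun p : (ℝ × ℝ) × ℝ => p.1.1 * p.1.2 + p.2) ((ρ.prod σ).prod μ)) s =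
      (∫ a, lap σ (s * a) ∂ρ) * lap μ s := by
  have := hσ.isProb
  have := hμ.isProb
  rw [lap, integral_map (by fun_prop) (by fun_prop)]
  have e : ∀ p : (ℝ × ℝ) × ℝ, Real.exp (-(s * (p.1.1 * p.1.2 + p.2))) =
      Real.exp (-(s * (p.1.1 * p.1.2))) * Real.exp (-(s * p.2)) := fun p => by
    rw [← Real.exp_add]
    congr 1
    ring
  simp only [e]
  rw [integral_prod_mul (fun q : ℝ × ℝ => Real.exp (-(s * (q.1 * q.2))))
    (fun y : ℝ => Real.exp (-(s * y)))]
  congr 1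
  rw [integral_prod]
  · refine integral_congr_ae (.of_forall fun a => ?_)
    simp only [lap, mul_assoc]
  · refine Integrable.of_bound (by fun_prop) 1 ?_
    have h1 : ∀ᵐ p ∂(ρ.prod σ), 0 < p.1 := Measure.quasiMeasurePreserving_fst.ae hpos
    have h2 : ∀ᵐ p ∂(ρ.prod σ), 0 ≤ p.2 := Measure.quasiMeasurePreserving_snd.ae hσ.ae_nonneg
    filter_upwards [h1, h2] with p h1 h2
    rw [Real.norm_eq_abs, Real.abs_exp, Real.exp_le_one_iff, neg_nonpos]
    positivity

theorem IsNonnegLaw.ext_lap (hμ : IsNonnegLaw μ) (hσ : IsNonnegLaw σ)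
    (h : ∀ s, 0 < s → lap μ s = lap σ s) : μ = σ := by
  have := hμ.isProb
  have := hσ.isProb
  refine ext_of_laplace hμ.neg_null hσ.neg_null fun s hs => ?_
  rcases hs.eq_or_lt with rfl | hs
  · exact hμ.lap_zero.trans hσ.lap_zero.symm
  · exact h s hs

/-- The perpetuity equation in terms of Laplace transforms. -/
theorem solvesPerpetuity_iff [IsProbabilityMeasure ρ] (hpos : ∀ᵐ a ∂ρ, 0 < a) :
    SolvesPerpetuity μ ρ ↔ IsNonnegLaw μ ∧ 0 < lawMean μ ∧ lawMean μ < ⊤ ∧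
      ∀ s, 0 < s → lap μ s = Real.exp (-lapExponent μ ρ s) := by
  unfold SolvesPerpetuity
  refine and_congr_right fun hμ => and_congr_right fun h0 => and_congr_right fun hm => ?_
  have hσ := hμ.sizeBiased_isNonnegLaw h0 hm
  have hR := isNonnegLaw_affine hpos hσ hμ
  have hm0 : (lawMean μ).toReal ≠ 0 := (ENNReal.toReal_pos h0.ne' hm.ne).ne'
  -- The normalisation 1/m occurs on both sides and cancels.
  have hlap : ∀ s, 0 < s →
      (lap (sizeBiased μ) s = lap (Measure.map (fun p : (ℝ × ℝ) × ℝ => p.1.1 * p.1.2 + p.2)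
        ((ρ.prod (sizeBiased μ)).prod μ)) s ↔
      lapJ μ s = (∫ z, lapJ μ (s * z) ∂ρ) * lap μ s) := fun s hs => by
    rw [lap_affine hpos hσ hμ hs.le]
    simp only [hμ.lap_sizeBiased]
    rw [integral_const_mul, mul_assoc, mul_right_inj' (inv_ne_zero hm0)]
  constructor
  · intro h s hs
    exact hμ.lap_eq_exp_of_lapJ_eq hm hpos (fun t ht => (hlap t ht).1 (congrArg (lap · t) h)) hs
  · intro h
    exact hσ.ext_lap hR fun s hs => (hlap s hs).2 (hμ.lapJ_eq_of_lap_eq_exp hm hpos h hs)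

end

/-! ### Passage between response functions and laws of A -/

/-- The law `-r x h^←(dx)`. -/
noncomputable def responseLaw (h : ℝ → ℝ) (r : ℝ) : Measure ℝ :=
  ENNReal.ofReal r • (imageMeasure h).withDensity (fun x => ENNReal.ofReal x)

namespace IsResponse

variable {h : ℝ → ℝ} {r : ℝ} {μ : Measure ℝ}

theorem responseLaw_ac (h : ℝ → ℝ) (r : ℝ) : responseLaw h r ≪ imageMeasure h := by
  unfold responseLaw
  exact Measure.AbsolutelyContinuous.smul_left (withDensity_absolutelyContinuous _ _) _

theorem ae_pos_responseLaw (hh : IsResponse h) : ∀ᵐ z ∂(responseLaw h r), 0 < z := by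
  have : responseLaw h r (Iic 0) = 0 := responseLaw_ac h r hh.imageMeasure_Iic
  filter_upwards [measure_eq_zero_iff_ae_notMem.1 this] with z hz
  simpa using hz

/-- The density z of the response law cancels z⁻¹. All quantities attached to ρ are translated into
integrals of `h` by this identity. -/
theorem lintegral_responseLaw (hh : IsResponse h) {F : ℝ → ℝ≥0∞} (hF : Measurable F)
    (hF0 : F 0 = 0) :
    ∫⁻ z, F z * ENNReal.ofReal z⁻¹ ∂(responseLaw h r) =
      ENNReal.ofReal r * ∫⁻ u in Ioi (0 : ℝ), F (h u) := by
  rw [responseLaw, lintegral_smul_measure, smul_eq_mul,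
    lintegral_withDensity_eq_lintegral_mul _ ENNReal.measurable_ofReal (by fun_prop),
    ← hh.lintegral_imageMeasure hF hF0]
  congr 1
  refine lintegral_congr_ae ?_
  filter_upwards [measure_eq_zero_iff_ae_notMem.1 hh.imageMeasure_Iic] with z hz
  have hz' : 0 < z := by simpa using hz
  rw [Pi.mul_apply, mul_left_comm, ← ENNReal.ofReal_mul hz'.le, mul_inv_cancel₀ hz'.ne',
    ENNReal.ofReal_one, mul_one]

theorem responseLaw_univ (hh : IsResponse h) : responseLaw h r univ =
    ENNReal.ofReal r * ∫⁻ z in Ioi (0 : ℝ), ENNReal.ofReal (h z) := by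
  rw [responseLaw, Measure.smul_apply, withDensity_apply _ MeasurableSet.univ, setLIntegral_univ,
    smul_eq_mul, hh.lintegral_imageMeasure ENNReal.measurable_ofReal ENNReal.ofReal_zero]

theorem hasNegIntegral_log_iff (hh : IsResponse h) (hr : 0 < r) :
    HasNegIntegral Real.log (responseLaw h r) ↔
      HasNegIntegral (fun z => h z * Real.log (h z)) (volume.restrict (Ioi (0 : ℝ))) := by
  have h1 : ∫⁻ z, ENNReal.ofReal (Real.log z) ∂(responseLaw h r) =
      ENNReal.ofReal r * ∫⁻ u in Ioi (0 : ℝ), ENNReal.ofReal (h u * Real.log (h u)) := by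
    rw [← hh.lintegral_responseLaw (F := fun z => ENNReal.ofReal (z * Real.log z)) (by fun_prop)
      (by simp)]
    refine lintegral_congr_ae ?_
    filter_upwards [hh.ae_pos_responseLaw] with z hz
    rw [← ENNReal.ofReal_mul' (inv_nonneg.2 hz.le)]
    congr 1
    field_simp
  have h2 : ∫⁻ z, ENNReal.ofReal (-Real.log z) ∂(responseLaw h r) =
      ENNReal.ofReal r * ∫⁻ u in Ioi (0 : ℝ), ENNReal.ofReal (-(h u * Real.log (h u))) := by
    rw [← hh.lintegral_responseLaw (F := fun z => ENNReal.ofReal (-(z * Real.log z)))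
      (by fun_prop) (by simp)]
    refine lintegral_congr_ae ?_
    filter_upwards [hh.ae_pos_responseLaw] with z hz
    rw [← ENNReal.ofReal_mul' (inv_nonneg.2 hz.le)]
    congr 1
    field_simp
  unfold HasNegIntegral
  rw [h1, h2]
  exact ENNReal.mul_lt_mul_iff_right (by simpa using hr) ENNReal.ofReal_ne_top

/-- Only the domain condition is used, so the exponent is available before the mean is known to be
finite. -/
theorem integrable_defect_div (hh : IsResponse h) (hd : InShotNoiseDomain h μ) {s : ℝ}
    (hs : 0 ≤ s) :
    Integrable (fun z => (1 - lap μ (s * z)) / z) (responseLaw h r) ∧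
      lapExponent μ (responseLaw h r) s =
        (ENNReal.ofReal r * ∫⁻ u in Ioi (0 : ℝ), ENNReal.ofReal (1 - lap μ (s * h u))).toReal := by
  have hμ := hd.1
  have hml := hμ.measurable_lap
  have hmeas : Measurable fun z => (1 - lap μ (s * z)) / z := by fun_prop
  have hnn : ∀ᵐ z ∂(responseLaw h r), 0 ≤ (1 - lap μ (s * z)) / z := by
    filter_upwards [hh.ae_pos_responseLaw] with z hz
    exact div_nonneg (sub_nonneg.2 (hμ.lap_le_one (mul_nonneg hs hz.le))) hz.le
  have hl : ∫⁻ z, ENNReal.ofReal ((1 - lap μ (s * z)) / z) ∂(responseLaw h r) =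
      ENNReal.ofReal r * ∫⁻ u in Ioi (0 : ℝ), ENNReal.ofReal (1 - lap μ (s * h u)) := by
    rw [← hh.lintegral_responseLaw (F := fun z => ENNReal.ofReal (1 - lap μ (s * z)))
      (by fun_prop) (by simp [hμ.lap_zero])]
    refine lintegral_congr_ae ?_
    filter_upwards [hh.ae_pos_responseLaw] with z hz
    rw [← ENNReal.ofReal_mul' (inv_nonneg.2 hz.le), div_eq_mul_inv]
  constructor
  · refine ⟨hmeas.aestronglyMeasurable, ?_⟩
    rw [hasFiniteIntegral_iff_ofReal hnn, hl]
    refine ENNReal.mul_lt_top ENNReal.ofReal_lt_top ?_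
    have h1 := (integrable_shotDefect hh hd hs).integrableOn (s := Ioi 0)
    have h2 := (hasFiniteIntegral_iff_ofReal
      (.of_forall (shotDefect_nonneg hh hμ hs))).1 h1.hasFiniteIntegral
    refine lt_of_eq_of_lt (setLIntegral_congr_fun measurableSet_Ioi fun u hu => ?_) h2
    simp only [shotDefect]
    rw [extendZero_of_pos h hu]
  · rw [lapExponent, integral_eq_lintegral_of_nonneg_ae hnn hmeas.aestronglyMeasurable, hl]

/-- The shot noise has the Laplace exponent given by its response law. -/
theorem lap_shotNoiseTransform_eq (hh : IsResponse h) (hr : 0 < r) (hd : InShotNoiseDomain h μ)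
    {s : ℝ} (hs : 0 < s) : lap (shotNoiseTransform h r μ) s =
      Real.exp (-lapExponent μ (responseLaw h r) s) := by
  have hμ := hd.1
  have hm : AEMeasurable h (volume.restrict (Ioi 0)) :=
    aemeasurable_restrict_of_antitoneOn measurableSet_Ioi hh.anti
  rw [lap_shotNoiseTransform hh hr hd hs, (hh.integrable_defect_div hd hs.le).2,
    ENNReal.toReal_mul, ENNReal.toReal_ofReal hr.le, integral_eq_lintegral_of_nonneg_ae]
  · refine (ae_restrict_iff' measurableSet_Ioi).2 (.of_forall fun u hu => ?_)
    exact sub_nonneg.2 (hμ.lap_le_one (mul_nonneg hs.le (hh.nonneg u hu)))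
  · exact ((hμ.measurable_lap.comp_aemeasurable (hm.const_mul s)).const_sub 1).aestronglyMeasurable

theorem shotNoiseTransform_eq_iff (hh : IsResponse h) (hr : 0 < r)
    (hd : InShotNoiseDomain h μ) : shotNoiseTransform h r μ = μ ↔
      ∀ s, 0 < s → lap μ s = Real.exp (-lapExponent μ (responseLaw h r) s) := by
  constructor
  · intro he s hs
    rw [← hh.lap_shotNoiseTransform_eq hr hd hs, he]
  · intro hl
    refine (isNonnegLaw_shotNoiseTransform hh hr hd.1).ext_lap hd.1 fun s hs => ?_
    rw [hh.lap_shotNoiseTransform_eq hr hd hs, hl s hs]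

theorem _root_.IsNonnegLaw.inShotNoiseDomain (hμ : IsNonnegLaw μ) (hm : lawMean μ < ⊤)
    (hint : ∫⁻ z in Ioi (0 : ℝ), ENNReal.ofReal (h z) < ⊤) : InShotNoiseDomain h μ := by
  refine ⟨hμ, ?_⟩
  have hle : ∀ᵐ y ∂μ, ∫⁻ s in Ioi (0 : ℝ), ENNReal.ofReal (min 1 (h s * y)) ≤
      (∫⁻ z in Ioi (0 : ℝ), ENNReal.ofReal (h z)) * ENNReal.ofReal y := by
    filter_upwards [hμ.ae_nonneg] with y hy
    rw [← lintegral_mul_const' _ _ ENNReal.ofReal_ne_top]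
    refine lintegral_mono fun s => ?_
    rw [← ENNReal.ofReal_mul' hy]
    exact ENNReal.ofReal_le_ofReal (min_le_right _ _)
  refine (lintegral_mono_ae hle).trans_lt ?_
  rw [lintegral_const_mul' _ _ hint.ne]
  exact ENNReal.mul_lt_top hint hm

/-- A non-zero fixed point of the shot-noise transform has finite mean. -/
theorem lawMean_lt_top (hh : IsResponse h) [IsProbabilityMeasure (responseLaw h r)]
    (hd : InShotNoiseDomain h μ) (hlog : HasNegIntegral Real.log (responseLaw h r))
    (hl : ∀ s, 0 < s → lap μ s = Real.exp (-lapExponent μ (responseLaw h r) s)) :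
    lawMean μ < ⊤ := by
  have hμ := hd.1
  refine lawMean_lt_top_of_defect_le hμ hh.ae_pos_responseLaw hlog fun s hs => ?_
  have hi := (hh.integrable_defect_div (r := r) hd hs.le).1
  have e : ∫⁻ a, ENNReal.ofReal ((1 - lap μ (s * a)) / (s * a)) ∂(responseLaw h r) =
      ENNReal.ofReal (lapExponent μ (responseLaw h r) s / s) := by
    rw [lapExponent, ← integral_div, ofReal_integral_eq_lintegral_ofReal (hi.div_const s)]
    · refine lintegral_congr fun a => ?_
      rw [div_div, mul_comm]
    · filter_upwards [hh.ae_pos_responseLaw] with z hz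
      exact div_nonneg (div_nonneg (sub_nonneg.2 (hμ.lap_le_one (mul_nonneg hs.le hz.le))) hz.le)
        hs.le
  rw [e, ← ENNReal.ofReal_mul (hμ.lap_pos hs.le).le]
  refine ENNReal.ofReal_le_ofReal ?_
  rw [← mul_div_assoc]
  refine div_le_div_of_nonneg_right ?_ hs.le
  set x := lapExponent μ (responseLaw h r) s
  -- From exp x ≥ x + 1 and φ exp x = 1 one gets φ x ≤ 1 - φ, the superharmonicity needed.
  have h1 := mul_le_mul_of_nonneg_left (Real.add_one_le_exp x) (hμ.lap_pos hs.le).le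
  have h2 : lap μ s * Real.exp x = 1 := by
    rw [hl s hs, ← Real.exp_add, neg_add_cancel, Real.exp_zero]
  linarith

/-- The response law charges only positive values of `h`; these are at least their infimum and, by
monotonicity, at most the limit at 0+. -/
theorem concentratedOn_responseLaw (hh : IsResponse h) {b : EReal}
    (hb : Tendsto (fun z => (h z : EReal)) (𝓝[>] (0 : ℝ)) (𝓝 b)) :
    ConcentratedOn (responseLaw h r)
      (sInf {x : ℝ | 0 < x ∧ ∃ u : ℝ, 0 < u ∧ h u = x}) b := by
  set a := sInf {x : ℝ | 0 < x ∧ ∃ u : ℝ, 0 < u ∧ h u = x} with ha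
  have hms : MeasurableSet {z : ℝ | a ≤ z ∧ (z : EReal) ≤ b} :=
    measurableSet_Ici.inter (measurable_coe_real_ereal measurableSet_Iic)
  refine responseLaw_ac h r ?_
  rw [imageMeasure, Measure.map_apply_of_aemeasurable hh.aemeasurable_pos hms.compl,
    Measure.restrict_apply' hh.measurableSet_pos]
  convert measure_empty (μ := volume)
  refine eq_empty_of_forall_notMem fun u hu => hu.1 ⟨?_, ?_⟩
  · exact csInf_le ⟨0, fun x hx => hx.1.le⟩ ⟨hu.2.2, u, hu.2.1, rfl⟩
  · refine ge_of_tendsto hb ?_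
    filter_upwards [Ioo_mem_nhdsGT hu.2.1] with v hv
    exact EReal.coe_le_coe_iff.2 (hh.anti hv.1 hu.2.1 hv.2.le)

end IsResponse

theorem lawMean_pos {μ : Measure ℝ} (hμ : IsNonnegLaw μ) (h : μ ≠ Measure.dirac 0) :
    0 < lawMean μ := by
  have := hμ.isProb
  rw [pos_iff_ne_zero]
  intro h0
  rw [lawMean, lintegral_eq_zero_iff ENNReal.measurable_ofReal] at h0
  have h1 : (id : ℝ → ℝ) =ᵐ[μ] fun _ => 0 := by
    filter_upwards [h0, hμ.ae_nonneg] with x hx hx0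
    exact le_antisymm (ENNReal.ofReal_eq_zero.1 hx) hx0
  apply h
  rw [← Measure.map_id (μ := μ), Measure.map_congr h1, Measure.map_const, measure_univ, one_smul]

/-- Every law on `(0, ∞)` is the response law of the inverse of its tail. -/
theorem exists_response_of_law {ρ : Measure ℝ} [IsProbabilityMeasure ρ]
    (hpos : ∀ᵐ a ∂ρ, 0 < a) : ∃ h, IsResponse h ∧
      (∀ x, 0 < x → genInv h x = ∫⁻ z in Ioi x, ENNReal.ofReal z⁻¹ ∂ρ) ∧
      responseLaw h 1 = ρ := by
  set κ := ρ.withDensity fun z => ENNReal.ofReal z⁻¹ with hκ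
  have hm : Measurable fun z : ℝ => ENNReal.ofReal z⁻¹ := by fun_prop
  have htail : ∀ x, κ (Ioi x) = ∫⁻ z in Ioi x, ENNReal.ofReal z⁻¹ ∂ρ := fun x =>
    withDensity_apply _ measurableSet_Ioi
  -- The bound 1/x makes the tail finite and supplies the witness x = 1/u that `invTail` needs.
  have hle : ∀ x, 0 < x → κ (Ioi x) ≤ ENNReal.ofReal x⁻¹ := by
    intro x hx
    rw [htail]
    refine (setLIntegral_mono (s := Ioi x) measurable_const (g := fun _ => ENNReal.ofReal x⁻¹)
      fun z hz => ENNReal.ofReal_le_ofReal (inv_anti₀ hx (mem_Ioi.1 hz).le)).trans ?_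
    rw [setLIntegral_const]
    exact mul_le_of_le_one_right' prob_le_one
  have hne : ∀ u, 0 < u → ∃ x, 0 < x ∧ κ (Ioi x) ≤ ENNReal.ofReal u := fun u hu =>
    ⟨u⁻¹, inv_pos.2 hu, by simpa using hle u⁻¹ (inv_pos.2 hu)⟩
  have hh := isResponse_invTail hne
  have hg : ∀ x, 0 < x → genInv (invTail κ) x = κ (Ioi x) := fun x hx => genInv_invTail hne hx
  refine ⟨invTail κ, hh, fun x hx => (hg x hx).trans (htail x), ?_⟩
  have hκ0 : κ (Iic 0) = 0 := by
    refine withDensity_absolutelyContinuous _ _ ?_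
    rw [measure_eq_zero_iff_ae_notMem]
    filter_upwards [hpos] with z hz
    simpa using hz
  have e := hh.eq_imageMeasure hκ0
    (fun x hx => (hg x hx).trans_lt ((hle x hx).trans_lt ENNReal.ofReal_lt_top)) hg
  rw [responseLaw, ← e, ENNReal.ofReal_one, one_smul, hκ,
    ← withDensity_mul _ hm ENNReal.measurable_ofReal]
  rw [withDensity_congr_ae (g := 1), withDensity_one]
  filter_upwards [hpos] with z hz
  rw [Pi.mul_apply, ← ENNReal.ofReal_mul (inv_nonneg.2 hz.le), inv_mul_cancel₀ hz.ne',
    ENNReal.ofReal_one, Pi.one_apply]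

theorem proposition2p1 :
    -- part (a)
    (∀ (μ ρ : Measure ℝ) (a : ℝ) (b : EReal),
      0 ≤ a → IsProbabilityMeasure ρ → ConcentratedOn ρ a b → ρ {0} = 0 →
      SolvesPerpetuity μ ρ → HasNegIntegral Real.log ρ →
      ∃ h : ℝ → ℝ,
        IsResponse h ∧
        (∀ x : ℝ, 0 < x →
          genInv h x = ∫⁻ z in {z : ℝ | x < z ∧ (z : EReal) ≤ b}, ENNReal.ofReal z⁻¹ ∂ρ) ∧
        (∀ h' : ℝ → ℝ, IsResponse h' →
          (∀ x : ℝ, 0 < x →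
            genInv h' x = ∫⁻ z in {z : ℝ | x < z ∧ (z : EReal) ≤ b}, ENNReal.ofReal z⁻¹ ∂ρ) →
          EqOn h' h (Ioi 0)) ∧
        IsShotNoiseFixedPoint h 1 μ ∧
        ∫⁻ z in Ioi (0 : ℝ), ENNReal.ofReal (h z) = 1 ∧
        HasNegIntegral (fun z => h z * Real.log (h z)) (volume.restrict (Ioi (0 : ℝ)))) ∧
    -- part (b)
    (∀ (μ : Measure ℝ) (r : ℝ) (h : ℝ → ℝ) (b : EReal),
      0 < r → IsResponse h → IsShotNoiseFixedPoint h r μ →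
      ENNReal.ofReal r * ∫⁻ z in Ioi (0 : ℝ), ENNReal.ofReal (h z) = 1 →
      HasNegIntegral (fun z => h z * Real.log (h z)) (volume.restrict (Ioi (0 : ℝ))) →
      0 < b → Tendsto (fun z => (h z : EReal)) (𝓝[>] (0 : ℝ)) (𝓝 b) →
      ∃ ν ρ : Measure ℝ,
        IsNegStieltjes (genInv h) ν ∧
        ρ = ENNReal.ofReal r • ν.withDensity (fun x => ENNReal.ofReal x) ∧
        IsProbabilityMeasure ρ ∧
        ConcentratedOn ρ (sInf {x : ℝ | 0 < x ∧ ∃ u : ℝ, 0 < u ∧ h u = x}) b ∧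
        SolvesPerpetuity μ ρ) := by
  constructor
  · intro μ ρ a b ha hρ hab h0 hsol hlog
    have hae : ∀ᵐ z ∂ρ, a ≤ z ∧ (z : EReal) ≤ b := by
      filter_upwards [measure_eq_zero_iff_ae_notMem.1 hab] with z hz
      simpa using hz
    have hpos : ∀ᵐ z ∂ρ, 0 < z := by
      filter_upwards [hae, measure_eq_zero_iff_ae_notMem.1 h0] with z hz hz0
      exact lt_of_le_of_ne (ha.trans hz.1) (fun hc => hz0 hc.symm)
    -- The restriction to z ≤ b holds ρ-almost everywhere, so `b` drops out of the tail.
    have hset : ∀ x : ℝ, ∫⁻ z in {z : ℝ | x < z ∧ (z : EReal) ≤ b}, ENNReal.ofReal z⁻¹ ∂ρ =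
        ∫⁻ z in Ioi x, ENNReal.ofReal z⁻¹ ∂ρ := by
      intro x
      refine setLIntegral_congr ?_
      filter_upwards [hae] with z hz
      exact propext ⟨fun hc => hc.1, fun hc => ⟨hc, hz.2⟩⟩
    simp only [hset]
    obtain ⟨h, hh, hinv, hlaw⟩ := exists_response_of_law hpos
    obtain ⟨hμ, hm0, hm, hlap⟩ := (solvesPerpetuity_iff hpos).1 hsol
    have hint : ∫⁻ z in Ioi (0 : ℝ), ENNReal.ofReal (h z) = 1 := by
      have := hh.responseLaw_univ (r := 1)
      rw [hlaw, measure_univ, ENNReal.ofReal_one, one_mul] at this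
      exact this.symm
    have hd := hμ.inShotNoiseDomain hm (hint.trans_lt ENNReal.one_lt_top)
    refine ⟨h, hh, hinv, fun h' hh' hinv' => ?_, ⟨hd, ?_, ?_⟩, hint, ?_⟩
    · exact hh.eqOn_of_genInv_eq hh' fun x hx => (hinv' x hx).trans (hinv x hx).symm
    · rintro rfl
      simp [lawMean] at hm0
    · rw [hh.shotNoiseTransform_eq_iff one_pos hd, hlaw]
      exact hlap
    · rw [← hh.hasNegIntegral_log_iff one_pos, hlaw]
      exact hlog
  · intro μ r h b hr hh hfix hint hlog _ hlim
    obtain ⟨hd, hne, hT⟩ := hfix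
    have hfin : ∫⁻ z in Ioi (0 : ℝ), ENNReal.ofReal (h z) < ⊤ := by
      rw [lt_top_iff_ne_top]
      intro hc
      rw [hc, ENNReal.mul_top (by simpa using hr)] at hint
      exact ENNReal.top_ne_one hint
    have hprob : IsProbabilityMeasure (responseLaw h r) := ⟨by rw [hh.responseLaw_univ, hint]⟩
    have hl := (hh.shotNoiseTransform_eq_iff hr hd).1 hT
    have hlog' := (hh.hasNegIntegral_log_iff hr).2 hlog
    exact ⟨imageMeasure h, responseLaw h r, hh.isNegStieltjes fun x hx => hh.genInv_lt_top hfin hx,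
      rfl, hprob, hh.concentratedOn_responseLaw hlim,
      (solvesPerpetuity_iff hh.ae_pos_responseLaw).2
        ⟨hd.1, lawMean_pos hd.1 hne, hh.lawMean_lt_top hd hlog' hl, hl⟩⟩
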